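/- Let $n\ge 1$ and equip $\mathbb{R}^{n+1}$ with the spherical metric $\overline g=\frac{4}{(1+r^2)^2}(dx_1^2+\dots+dx_{n+1}^2)$, $r^2=x_1^2+\dots+x_{n+1}^2$ (constant curvature $+1$). Identify $\mathbb{R}^n$ with the hyperplane $H=\{x_{n+1}=0\}$, and let $K=\{x\in\mathbb{R}^n: x_1\ge 0\}$, $p_0=0$, $f(x)=x_1$ and $$U=\Big\{x\in\mathbb{R}^n:\ -\tfrac32<3x_1^2-1-x_2^2-\dots-x_n^2<0\Big\}\cap B(0,1),$$ with $B(0,1)$ the Euclidean open unit ball. For $\lambda\in(0,1)$ let $F_\lambda(x,x_{n+1})=x_{n+1}^2-\lambda^2x_1$, let $M_\lambda=\{(x,x_{n+1})\in U\times\mathbb{R}: F_\lambda(x,x_{n+1})=0\}$ be the fold over $K\cap U$, with the metric induced by $\overline g$, and let $$\xi_\lambda(x)=\frac{\lambda^2x_1(3x_1^2-1-x_2^2-\dots-x_n^2)}{(4x_1+\lambda^2)^2}.$$ Definitions. A set $K\subset\mathbb{R}^n$ is described by $f$ in an open bounded set $U$ if $f\in C^2(\overline U)$ has $0$ as a regular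 value, $K\cap U=\{x\in U: f(x)\ge0\}$ and $\partial K\cap U=\{x\in U:f(x)=0\}$. A billiard table is the closure of a connected open subset of $\mathbb{R}^n$ that is described by some such function near each of its boundary points. The folds over $K\cap U$ are the sets $\{(x,x_{n+1})\in U\times\mathbb{R}: x_{n+1}^2=\lambda^2f(x)\}$, $\lambda\in(0,1)$. An orientable smooth hypersurface without boundary has curvature bounded below by $\kappa$ if all its sectional curvatures are at least $\kappa$. Assumption (H) for $K$ at $p_0$ says that there are an open bounded neighborhood $U$ of $p_0$, a function $f$ describing $K$ in $U$, and $\kappa\in\mathbb{R}$ such that for every $\lambda\in(0,1)$ the fold over $K\cap U$ is an orientable smooth hypersurface without boundary of curvature bounded below by $\kappa$. Then $K$ is a billiard table, $p_0\in\partial K$, $U$ is an open bounded neighborhood of $p_0$ in which $f$ describes $K$, and for all $\lambda\in(0,1)$ and $q=(x,x_{n+1})\in M_\lambda$: 1. $T_qM_\lambda$ has the basis $v_1=2x_{n+1}e_1+\lambda^2e_{n+1}$, $v_i=e_i$ for $2\le i\le n$. 2. $\operatorname{grad}F_\lambda(q)=\frac{(1+r^2)^2}{4}(-\lambda^2e_1+2x_{n+1}e_{n+1})$.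 3. $v_i^T\operatorname{Hess}F_\lambda(q)\,v_j$ equals $2\lambda^4-\frac{8\lambda^4x_1^2}{1+r^2}-\frac{2\lambda^6x_1}{1+r^2}$ if $i=j=1$, equals $-\frac{2\lambda^2x_1}{1+r^2}$ if $i=j\ne1$, and equals $0$ if $i\neq j$. 4. The sectional curvatures of $M_\lambda$ at $q$ satisfy $$\sec(v_i,v_j)=1+\frac{4\lambda^4x_1^2}{(1+r^2)^2\,\|\operatorname{grad}F_\lambda(q)\|^2\,\overline g_q(v_i,v_i)\,\overline g_q(v_j,v_j)}\quad(i,j\ge2,\ i\ne j),\qquad \sec(v_1,v_j)=1+\xi_\lambda(x)\quad(j\ge2).$$ 5. Every sectional curvature of $M_\lambda$ at $q$ is at least $1+\xi_\lambda(x)$. Moreover $\xi_\lambda\ge-\frac{3}{32}$ on $K\cap U$ for every $\lambda\in(0,1)$, hence $1+\xi_\lambda\ge 0$ there; every $M_\lambda$ is an orientable smooth hypersurface without boundary of curvature bounded below by $0$; and Assumption (H) holds for $K$ at $p_0$. -/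

import Mathlib

open scoped ContDiff

namespace Folds

/-- Euclidean space `ℝ^m`. -/
abbrev Euc (m : ℕ) : Type := EuclideanSpace ℝ (Fin m)

/-- The canonical basis vector `e_i`. -/
noncomputable def e {m : ℕ} (i : Fin m) : Euc m := EuclideanSpace.single i (1 : ℝ)

/-- The partial derivative `∂_i f`. -/
noncomputable def pd {m : ℕ} (i : Fin m) (f : Euc m → ℝ) (x : Euc m) : ℝ := fderiv ℝ f x (e i)

/-! ### Riemannian metrics in coordinates -/

/-- A field of coefficient matrices `(g_ij)` on (an open subset of) `ℝ^m`. -/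
abbrev Coeffs (m : ℕ) : Type := Euc m → Matrix (Fin m) (Fin m) ℝ

/-- `g_x(u, w)`. -/
noncomputable def ip {m : ℕ} (g : Coeffs m) (x u w : Euc m) : ℝ :=
  ∑ i, ∑ j, g x i j * u i * w j

/-- The Christoffel symbol `Γ^k_ij` of the Levi-Civita connection of `g`. -/
noncomputable def christoffel {m : ℕ} (g : Coeffs m) (i j k : Fin m) (x : Euc m) : ℝ :=
  (1 / 2) * ∑ l, (g x)⁻¹ k l *
    (pd i (fun z => g z j l) x + pd j (fun z => g z i l) x - pd l (fun z => g z i j) x)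

/-- The Riemannian gradient, with components `g^{ij} ∂_j F`. -/
noncomputable def grad {m : ℕ} (g : Coeffs m) (F : Euc m → ℝ) (x : Euc m) : Euc m :=
  ∑ i, (∑ j, (g x)⁻¹ i j * pd j F x) • e i

/-- The Riemannian Hessian matrix, with entries `∂_i ∂_j F - Γ^k_ij ∂_k F`. -/
noncomputable def hess {m : ℕ} (g : Coeffs m) (F : Euc m → ℝ) (x : Euc m) :
    Matrix (Fin m) (Fin m) ℝ :=
  Matrix.of fun i j => pd i (pd j F) x - ∑ k, christoffel g i j k x * pd k F x

/-- `uᵀ A w`. -/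
noncomputable def bil {m : ℕ} (A : Matrix (Fin m) (Fin m) ℝ) (u w : Euc m) : ℝ :=
  ∑ i, ∑ j, u i * A i j * w j

/-- The component `R_ijk^l` of the curvature tensor:
`R(∂_i, ∂_j) ∂_k = ∇_i ∇_j ∂_k - ∇_j ∇_i ∂_k = ∑_l R_ijk^l ∂_l`. -/
noncomputable def curv {m : ℕ} (g : Coeffs m) (i j k l : Fin m) (x : Euc m) : ℝ :=
  pd i (christoffel g j k l) x - pd j (christoffel g i k l) x
    + ∑ p, (christoffel g j k p x * christoffel g i p l x
      - christoffel g i k p x * christoffel g j p l x)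

/-- `R(u, w) z` at `x`. -/
noncomputable def curvVec {m : ℕ} (g : Coeffs m) (x u w z : Euc m) : Euc m :=
  ∑ l, (∑ i, ∑ j, ∑ k, curv g i j k l x * u i * w j * z k) • e l

/-- The sectional curvature `g(R(u,w)w, u) / (g(u,u) g(w,w) - g(u,w)²)` at `x` in coordinates. -/
noncomputable def coordSec {m : ℕ} (g : Coeffs m) (x u w : Euc m) : ℝ :=
  ip g x (curvVec g x u w w) u / (ip g x u u * ip g x w w - ip g x u w ^ 2)

/-! ### Hypersurfaces of `ℝ^{n+1}` -/

/-- `ψ : V → M` is a smooth local parametrization of `M ⊆ ℝ^{n+1}`: a smooth immersion of the open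
set `V ⊆ ℝ^n` which is a homeomorphism onto a relatively open subset of `M`. -/
structure IsLocalParam {n : ℕ} (M : Set (Euc (n + 1))) (V : Set (Euc n))
    (ψ : Euc n → Euc (n + 1)) : Prop where
  isOpen : IsOpen V
  smooth : ContDiffOn ℝ ∞ ψ V
  immersion : ∀ y ∈ V, Function.Injective (fderiv ℝ ψ y)
  embedding : Topology.IsEmbedding (V.domRestrict ψ)
  image : ∃ W : Set (Euc (n + 1)), IsOpen W ∧ ψ '' V = M ∩ W

/-- The tangent space `T_q M`: the velocities at `q` of smooth curves in `M`. -/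
def tangentVectors {m : ℕ} (M : Set (Euc m)) (q : Euc m) : Set (Euc m) :=
  {v | ∃ (ε : ℝ) (γ : ℝ → Euc m), 0 < ε ∧ ContDiffOn ℝ ∞ γ (Set.Ioo (-ε) ε) ∧
    (∀ t ∈ Set.Ioo (-ε) ε, γ t ∈ M) ∧ γ 0 = q ∧ HasDerivAt γ v 0}

/-- `M ⊆ ℝ^{n+1}` is an orientable smooth embedded hypersurface (without boundary). -/
structure IsOrientableHypersurface {n : ℕ} (M : Set (Euc (n + 1))) : Prop where
  charts : ∀ q ∈ M, ∃ (V : Set (Euc n)) (ψ : Euc n → Euc (n + 1)),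
    IsLocalParam M V ψ ∧ q ∈ ψ '' V
  orientable : ∃ ν : Euc (n + 1) → Euc (n + 1), ContinuousOn ν M ∧
    ∀ q ∈ M, ν q ≠ 0 ∧ ∀ v ∈ tangentVectors M q, inner ℝ (ν q) v = 0

/-- The coefficients of the pulled back metric `ψ^* g`. -/
noncomputable def pullback {n : ℕ} (g : Coeffs (n + 1)) (ψ : Euc n → Euc (n + 1)) : Coeffs n :=
  fun y => Matrix.of fun i j => ip g (ψ y) (fderiv ℝ ψ y (e i)) (fderiv ℝ ψ y (e j))

/-- `s` is the sectional curvature at `q`, computed in some local parametrization of `M`, of the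
induced metric on `M` and the plane spanned by the tangent vectors `u, w`. -/
def IsSecInChart {n : ℕ} (g : Coeffs (n + 1)) (M : Set (Euc (n + 1))) (q u w : Euc (n + 1))
    (s : ℝ) : Prop :=
  ∃ (V : Set (Euc n)) (ψ : Euc n → Euc (n + 1)) (y a b : Euc n),
    IsLocalParam M V ψ ∧ y ∈ V ∧ ψ y = q ∧ fderiv ℝ ψ y a = u ∧ fderiv ℝ ψ y b = w ∧
    s = coordSec (pullback g ψ) y a b

/-- The sectional curvature at `q` of `M`, with the metric induced by `g`, of the plane spanned by
the tangent vectors `u, w` is `s`: local parametrizations around `q` exist, and every one of them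
gives the value `s`. -/
def HasSec {n : ℕ} (g : Coeffs (n + 1)) (M : Set (Euc (n + 1))) (q u w : Euc (n + 1))
    (s : ℝ) : Prop :=
  ∀ t : ℝ, IsSecInChart g M q u w t ↔ t = s

/-- The hypersurface `M` (without boundary), with the metric induced by `g`, is a space of curvature
bounded below by `κ`. -/
def CurvatureBoundedBelow {n : ℕ} (g : Coeffs (n + 1)) (M : Set (Euc (n + 1))) (κ : ℝ) : Prop :=
  IsOrientableHypersurface M ∧ ∀ q ∈ M, ∀ u ∈ tangentVectors M q, ∀ w ∈ tangentVectors M q,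
    LinearIndependent ℝ ![u, w] → ∃ s : ℝ, HasSec g M q u w s ∧ κ ≤ s

/-! ### Billiard tables and folds

The hyperplane `H = {x_{n+1} = 0}` of `ℝ^{n+1}` is identified with `ℝ^n`. -/

/-- `f ∈ C²(closure U)` has the regular value `0` and describes `K` and its boundary in the open
bounded set `U`. -/
structure IsDefiningFunction {n : ℕ} (K U : Set (Euc n)) (f : Euc n → ℝ) : Prop where
  isOpen : IsOpen U
  bounded : Bornology.IsBounded U
  smooth : ∃ W : Set (Euc n), IsOpen W ∧ closure U ⊆ W ∧ ContDiffOn ℝ 2 f W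
  regular : ∀ x ∈ U, f x = 0 → fderiv ℝ f x ≠ 0
  table : K ∩ U = {x ∈ U | 0 ≤ f x}
  boundary : frontier K ∩ U = {x ∈ U | f x = 0}

/-- `K` is the closure of a connected open set and has boundary of class `C²`. -/
def IsBilliardTable {n : ℕ} (K : Set (Euc n)) : Prop :=
  (∃ Ω : Set (Euc n), IsOpen Ω ∧ IsConnected Ω ∧ K = closure Ω) ∧
  ∀ p ∈ frontier K, ∃ (U : Set (Euc n)) (f : Euc n → ℝ), p ∈ U ∧ IsDefiningFunction K U f

/-- `(x, x_{n+1}) ↦ x`. -/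
noncomputable def proj {n : ℕ} (q : Euc (n + 1)) : Euc n :=
  WithLp.toLp 2 fun i => q i.castSucc

/-- `F_λ(x, x_{n+1}) = x_{n+1}² - λ² f(x)`. -/
noncomputable def foldFun {n : ℕ} (f : Euc n → ℝ) (lam : ℝ) (q : Euc (n + 1)) : ℝ :=
  q (Fin.last n) ^ 2 - lam ^ 2 * f (proj q)

/-- The fold `M_λ = {(x, x_{n+1}) ∈ U × ℝ : x_{n+1}² = λ² f(x)}`. -/
def fold {n : ℕ} (U : Set (Euc n)) (f : Euc n → ℝ) (lam : ℝ) : Set (Euc (n + 1)) :=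
  {q | proj q ∈ U ∧ q (Fin.last n) ^ 2 = lam ^ 2 * f (proj q)}

/-- Assumption (H) for the table `K`, the boundary point `p₀` and the metric `g`: over a
neighbourhood of `p₀`, the folds have curvature bounded below uniformly in `λ ∈ (0,1)`. -/
def AssumptionH {n : ℕ} (g : Coeffs (n + 1)) (K : Set (Euc n)) (p₀ : Euc n) : Prop :=
  ∃ (U : Set (Euc n)) (f : Euc n → ℝ), p₀ ∈ U ∧ IsDefiningFunction K U f ∧
    ∃ κ : ℝ, ∀ lam ∈ Set.Ioo (0 : ℝ) 1, CurvatureBoundedBelow g (fold U f lam) κ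

/-! ### The half-space in the spherical metric -/

/-- The spherical metric `4 / (1 + r²)² (dx_1² + ... + dx_m²)`. -/
noncomputable def sphericalMetric {m : ℕ} : Coeffs m :=
  fun x => (4 / (1 + ‖x‖ ^ 2) ^ 2) • (1 : Matrix (Fin m) (Fin m) ℝ)

/-- The half-space `K = {x_1 ≥ 0}`. -/
def halfSpace (n : ℕ) [NeZero n] : Set (Euc n) := {x | 0 ≤ x 0}

/-- The function `f(x) = x_1`. -/
def firstCoord (n : ℕ) [NeZero n] : Euc n → ℝ := fun x => x 0

/-- `3 x_1² - 1 - x_2² - ... - x_n²`. -/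
noncomputable def quad {n : ℕ} [NeZero n] (x : Euc n) : ℝ :=
  3 * x 0 ^ 2 - 1 - ∑ i ∈ Finset.univ.erase (0 : Fin n), x i ^ 2

/-- The neighbourhood `U` of the origin. -/
def nbhd (n : ℕ) [NeZero n] : Set (Euc n) :=
  {x | -(3 / 2) < quad x ∧ quad x < 0} ∩ Metric.ball 0 1

/-- `ξ_λ(x) = λ² x_1 (3 x_1² - 1 - x_2² - ... - x_n²) / (4 x_1 + λ²)²`. -/
noncomputable def xi {n : ℕ} [NeZero n] (lam : ℝ) (x : Euc n) : ℝ :=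
  lam ^ 2 * x 0 * quad x / (4 * x 0 + lam ^ 2) ^ 2

/-- The vectors `v_1 = 2 x_{n+1} e_1 + λ² e_{n+1}` (index `0`) and `v_i = e_i`, `2 ≤ i ≤ n`. -/
noncomputable def frame {n : ℕ} [NeZero n] (lam : ℝ) (q : Euc (n + 1)) (i : Fin n) : Euc (n + 1) :=
  if i = 0 then (2 * q (Fin.last n)) • e 0 + lam ^ 2 • e (Fin.last n) else e i.castSucc

end Folds

open Folds

/-! ### Metrics induced by immersions into an inner product space. -/

namespace Folds

variable {E : Type*} [NormedAddCommGroup E] [InnerProductSpace ℝ E] {m : ℕ}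

/-! Inverse stereographic projection `stereo` is an isometry from the spherical metric to a unit
sphere in a flat space of dimension n+2. With Z = 2/(1+r²), the image Y of a point has the
coordinates Z·x_1, Z·x_{n+1} and, along `stereoNorth`, Z. The equation x_{n+1}² = λ²x_1 therefore
becomes homogeneous quadratic in Y, and the fold becomes a piece of the intersection of the sphere
with a quadratic cone, of codimension two in a flat space.

The Gauss equation, proved for an arbitrary immersion in `IsInducedMetric.gauss`, then gives the
curvature. Two normals are affine functions of Y: the radial vector and `foldOp` applied to Y. Hence
`inner_fderiv_fderiv` finds the second fundamental form against them from first derivatives of the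
immersion alone. The radial normal contributes the constant 1. The cone normal, made orthogonal to
it, contributes the Hessian of F_λ on the tangent space. The result, `IsFoldImmersion.coordSec_eq`,
depends only on the point and the two tangent vectors, so all charts agree, and evaluating it on the
frame gives the explicit formulas.

For the lower bound, the restricted Hessian is a rank-one form minus a nonnegative multiple of the
Euclidean inner product. This makes the sectional curvature of span(u, w) minus 1+ξ a nonnegative
multiple of the Gram determinant of v_1, u, w (`xi_le_foldSec`). The bound on ξ is the
arithmetic-geometric mean inequality (`neg_le_xi`). -/

lemma contDiffAt_fderiv_const {F G : Type*} [NormedAddCommGroup F] [NormedSpace ℝ F]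
    [NormedAddCommGroup G] [NormedSpace ℝ G] {f : F → G} {y : F} (h : ContDiffAt ℝ ∞ f y) (v : F) :
    ContDiffAt ℝ ∞ (fun z => fderiv ℝ f z v) y :=
  (h.fderiv_right (m := ∞) (by simp)).clm_apply contDiffAt_const

lemma fderiv_fderiv_const {F G : Type*} [NormedAddCommGroup F] [NormedSpace ℝ F]
    [NormedAddCommGroup G] [NormedSpace ℝ G] {f : F → G} {y : F} (h : ContDiffAt ℝ ∞ f y)
    (v w : F) : fderiv ℝ (fun z => fderiv ℝ f z v) y w = fderiv ℝ (fderiv ℝ f) y w v := by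
  have h1 : DifferentiableAt ℝ (fderiv ℝ f) y :=
    (h.fderiv_right (m := ∞) (by simp)).differentiableAt (by simp)
  rw [fderiv_clm_apply h1 (differentiableAt_const v)]
  simp

lemma fderiv_fderiv_comm {F G : Type*} [NormedAddCommGroup F] [NormedSpace ℝ F]
    [NormedAddCommGroup G] [NormedSpace ℝ G] {f : F → G} {y : F} (h : ContDiffAt ℝ ∞ f y)
    (v w : F) : fderiv ℝ (fderiv ℝ f) y v w = fderiv ℝ (fderiv ℝ f) y w v :=
  (h.isSymmSndFDerivAt (by
    rw [minSmoothness_of_isRCLikeNormedField]; exact WithTop.coe_le_coe.mpr le_top)).eq v w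

lemma sum_smul_e (a : Euc m) : ∑ i, a i • (e i : Euc m) = a := by
  ext j
  simp [e, Finset.sum_apply, Pi.single_apply]

lemma ip_eq_sum_sum_mul (g : Coeffs m) (x u w : Euc m) :
    ip g x u w = ∑ j, (∑ i, g x i j * u i) * w j := by
  unfold ip
  rw [Finset.sum_comm]
  simp [Finset.sum_mul]

/-- `g` is the metric induced on the open set `V` by the immersion `Ψ` into `E`. -/
structure IsInducedMetric (V : Set (Euc m)) (Ψ : Euc m → E) (g : Coeffs m) : Prop where
  isOpen : IsOpen V
  smooth : ∀ y ∈ V, ContDiffAt ℝ ∞ Ψ y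
  immersion : ∀ y ∈ V, Function.Injective (fderiv ℝ Ψ y)
  eq_inner : ∀ y ∈ V, ∀ i j, g y i j = inner ℝ (fderiv ℝ Ψ y (e i)) (fderiv ℝ Ψ y (e j))

namespace IsInducedMetric

variable {V : Set (Euc m)} {Ψ : Euc m → E} {g : Coeffs m}

lemma symm (h : IsInducedMetric V Ψ g) {y : Euc m} (hy : y ∈ V) (i j : Fin m) :
    g y i j = g y j i := by
  rw [h.eq_inner y hy, h.eq_inner y hy, real_inner_comm]

lemma eventuallyEq (h : IsInducedMetric V Ψ g) {y : Euc m} (hy : y ∈ V) (i j : Fin m) :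
    (fun z => g z i j) =ᶠ[nhds y]
      fun z => inner ℝ (fderiv ℝ Ψ z (e i)) (fderiv ℝ Ψ z (e j)) :=
  Filter.eventuallyEq_of_mem (h.isOpen.mem_nhds hy) fun z hz => h.eq_inner z hz i j

lemma contDiffAt (h : IsInducedMetric V Ψ g) {y : Euc m} (hy : y ∈ V) (i j : Fin m) :
    ContDiffAt ℝ ∞ (fun z => g z i j) y :=
  ((contDiffAt_fderiv_const (h.smooth y hy) (e i)).inner ℝ
    (contDiffAt_fderiv_const (h.smooth y hy) (e j))).congr_of_eventuallyEq (h.eventuallyEq hy i j)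

lemma ip_eq (h : IsInducedMetric V Ψ g) {y : Euc m} (hy : y ∈ V) (a b : Euc m) :
    ip g y a b = inner ℝ (fderiv ℝ Ψ y a) (fderiv ℝ Ψ y b) := by
  conv_rhs => rw [← sum_smul_e a, ← sum_smul_e b]
  simp only [ip, map_sum, map_smul, sum_inner, inner_sum, real_inner_smul_left,
    real_inner_smul_right, h.eq_inner y hy]
  rw [Finset.sum_comm]
  refine Finset.sum_congr rfl fun i _ => Finset.sum_congr rfl fun j _ => by ring

/-- A null vector v of the matrix would satisfy ‖dΨ(v)‖² = g(v,v) = 0, against injectivity of dΨ. -/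
lemma det_ne_zero (h : IsInducedMetric V Ψ g) {y : Euc m} (hy : y ∈ V) : (g y).det ≠ 0 := by
  intro h0
  obtain ⟨v, hv, hv0⟩ := Matrix.exists_mulVec_eq_zero_iff.mpr h0
  apply hv
  have h1 : ip g y (WithLp.toLp 2 v) (WithLp.toLp 2 v) = 0 := by
    have : ip g y (WithLp.toLp 2 v) (WithLp.toLp 2 v) = ∑ i, v i * (Matrix.mulVec (g y) v) i := by
      simp only [ip, Matrix.mulVec, dotProduct, Finset.mul_sum]
      refine Finset.sum_congr rfl fun i _ => Finset.sum_congr rfl fun j _ => by ring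
    rw [this, hv0]; simp
  rw [h.ip_eq hy, inner_self_eq_zero] at h1
  have h2 := h.immersion y hy (h1.trans (map_zero _).symm)
  exact congrArg WithLp.ofLp h2

lemma pd_metric (h : IsInducedMetric V Ψ g) {y : Euc m} (hy : y ∈ V) (k i j : Fin m) :
    pd k (fun z => g z i j) y =
      inner ℝ (fderiv ℝ (fderiv ℝ Ψ) y (e k) (e i)) (fderiv ℝ Ψ y (e j)) +
      inner ℝ (fderiv ℝ Ψ y (e i)) (fderiv ℝ (fderiv ℝ Ψ) y (e k) (e j)) := by
  have hs := h.smooth y hy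
  rw [pd, (h.eventuallyEq hy i j).fderiv_eq, fderiv_inner_apply ℝ
    ((contDiffAt_fderiv_const hs _).differentiableAt (by simp))
    ((contDiffAt_fderiv_const hs _).differentiableAt (by simp)),
    fderiv_fderiv_const hs, fderiv_fderiv_const hs, add_comm]

/-- Koszul formula: lowering the index cancels g⁻¹, and of the six products obtained by
differentiating the metric four cancel by symmetry of D²Ψ. The Christoffel symbols thus encode the
tangential part of D²Ψ. -/
lemma sum_christoffel (h : IsInducedMetric V Ψ g) {y : Euc m} (hy : y ∈ V) (i j l : Fin m) :
    ∑ k, g y l k * christoffel g i j k y =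
      inner ℝ (fderiv ℝ (fderiv ℝ Ψ) y (e i) (e j)) (fderiv ℝ Ψ y (e l)) := by
  have hs := h.smooth y hy
  have hunit : IsUnit (g y).det := isUnit_iff_ne_zero.mpr (h.det_ne_zero hy)
  have key : ∀ X : Fin m → ℝ, ∑ k, g y l k * ((1 / 2) * ∑ p, (g y)⁻¹ k p * X p) = 1 / 2 * X l := by
    intro X
    have : ∑ k, g y l k * ((1 / 2) * ∑ p, (g y)⁻¹ k p * X p)
        = 1 / 2 * (Matrix.mulVec (g y) (Matrix.mulVec (g y)⁻¹ X)) l := by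
      simp only [Matrix.mulVec, dotProduct, Finset.mul_sum]
      refine Finset.sum_congr rfl fun i _ => Finset.sum_congr rfl fun j _ => by ring
    rw [this, Matrix.mulVec_mulVec, Matrix.mul_nonsing_inv _ hunit, Matrix.one_mulVec]
  unfold christoffel
  rw [key, h.pd_metric hy, h.pd_metric hy, h.pd_metric hy, fderiv_fderiv_comm hs (e j) (e i),
    fderiv_fderiv_comm hs (e l) (e i), fderiv_fderiv_comm hs (e l) (e j)]
  rw [real_inner_comm (fderiv ℝ (fderiv ℝ Ψ) y (e i) (e l)) (fderiv ℝ Ψ y (e j))]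
  ring

end IsInducedMetric

lemma contDiffAt_det {k : ℕ} {F : Type*} [NormedAddCommGroup F] [NormedSpace ℝ F]
    {A : F → Matrix (Fin k) (Fin k) ℝ} {y : F}
    (h : ∀ i j, ContDiffAt ℝ ∞ (fun z => A z i j) y) : ContDiffAt ℝ ∞ (fun z => (A z).det) y := by
  simp only [Matrix.det_apply]
  exact ContDiffAt.sum fun σ _ => (contDiffAt_prod fun i _ => h _ _).const_smul _

/-- Cramer's rule: each entry is a quotient of determinants, the numerator having one row replaced
by a constant one. -/
lemma contDiffAt_inv {k : ℕ} {F : Type*} [NormedAddCommGroup F] [NormedSpace ℝ F]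
    {A : F → Matrix (Fin k) (Fin k) ℝ} {y : F}
    (h : ∀ i j, ContDiffAt ℝ ∞ (fun z => A z i j) y) (h0 : (A y).det ≠ 0) (i j : Fin k) :
    ContDiffAt ℝ ∞ (fun z => (A z)⁻¹ i j) y := by
  simp only [Matrix.inv_def, Matrix.smul_apply, Ring.inverse_eq_inv', Matrix.adjugate_apply,
    smul_eq_mul]
  refine ((contDiffAt_det h).inv h0).mul (contDiffAt_det fun p q => ?_)
  by_cases hp : p = j
  · subst hp
    simp only [Matrix.updateRow_self]
    exact contDiffAt_const
  · simp only [Matrix.updateRow_ne hp]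
    exact h p q

/-! ### The second fundamental form and the Gauss equation. -/

namespace IsInducedMetric

variable {V : Set (Euc m)} {Ψ : Euc m → E} {g : Coeffs m}

lemma differentiableAt_christoffel (h : IsInducedMetric V Ψ g) {y : Euc m} (hy : y ∈ V)
    (i j k : Fin m) : DifferentiableAt ℝ (christoffel g i j k) y := by
  have hpd : ∀ k i j, ContDiffAt ℝ ∞ (pd k (fun z => g z i j)) y := fun k i j =>
    contDiffAt_fderiv_const (h.contDiffAt hy i j) (e k)
  have : ContDiffAt ℝ ∞ (christoffel g i j k) y := by
    unfold christoffel
    exact contDiffAt_const.mul (ContDiffAt.sum fun l _ =>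
      (contDiffAt_inv (h.contDiffAt hy) (h.det_ne_zero hy) k l).mul
        (((hpd _ _ _).add (hpd _ _ _)).sub (hpd _ _ _)))
  exact this.differentiableAt (by simp)

/-- The coefficients of the second fundamental form. -/
noncomputable def secondForm (Ψ : Euc m → E) (g : Coeffs m) (y : Euc m) (i j : Fin m) : E :=
  fderiv ℝ (fderiv ℝ Ψ) y (e i) (e j) - ∑ k, christoffel g i j k y • fderiv ℝ Ψ y (e k)

lemma inner_secondForm (h : IsInducedMetric V Ψ g) {y : Euc m} (hy : y ∈ V) (i j l : Fin m) :
    inner ℝ (secondForm Ψ g y i j) (fderiv ℝ Ψ y (e l)) = 0 := by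
  rw [secondForm, inner_sub_left, ← h.sum_christoffel hy, sum_inner, sub_eq_zero]
  refine Finset.sum_congr rfl fun k _ => ?_
  rw [real_inner_smul_left, h.symm hy l k, h.eq_inner y hy]
  ring

/-- This is `sum_christoffel` differentiated in the direction e_i. The third-derivative term is
symmetric in i and j, so it disappears when the curvature is antisymmetrised. -/
lemma sum_pd_christoffel (h : IsInducedMetric V Ψ g) {y : Euc m} (hy : y ∈ V) (i j k q : Fin m) :
    ∑ l, g y q l * (pd i (christoffel g j k l) y
        + ∑ p, christoffel g j k p y * christoffel g i p l y) =
      inner ℝ (fderiv ℝ (fderiv ℝ fun z => fderiv ℝ Ψ z (e k)) y (e i) (e j)) (fderiv ℝ Ψ y (e q))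
      + inner ℝ (secondForm Ψ g y j k) (secondForm Ψ g y i q) := by
  have hs := h.smooth y hy
  have hk := contDiffAt_fderiv_const hs (e k)
  have h1 : (fun z => ∑ l, g z q l * christoffel g j k l z) =ᶠ[nhds y]
      fun z => inner ℝ (fderiv ℝ (fun z => fderiv ℝ Ψ z (e k)) z (e j)) (fderiv ℝ Ψ z (e q)) :=
    Filter.eventuallyEq_of_mem (h.isOpen.mem_nhds hy) fun z hz => by
      simp only [h.sum_christoffel hz, fderiv_fderiv_const (h.smooth z hz)]
  have h2 := congrArg (fun L : Euc m →L[ℝ] ℝ => L (e i)) h1.fderiv_eq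
  beta_reduce at h2
  rw [fderiv_inner_apply ℝ
    ((contDiffAt_fderiv_const hk _).differentiableAt (by simp))
    ((contDiffAt_fderiv_const hs _).differentiableAt (by simp)),
    fderiv_fderiv_const hs, fderiv_fderiv_const hs, fderiv_fderiv_const hk,
    fderiv_fun_sum fun l _ => ((h.contDiffAt hy q l).differentiableAt (by simp)).fun_mul
      (h.differentiableAt_christoffel hy j k l)] at h2
  have h3 : ∀ l, fderiv ℝ (fun z => g z q l * christoffel g j k l z) y (e i)
      = g y q l * pd i (christoffel g j k l) y
        + christoffel g j k l y * pd i (fun z => g z q l) y := fun l => by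
    rw [fderiv_fun_mul ((h.contDiffAt hy q l).differentiableAt (by simp))
      (h.differentiableAt_christoffel hy j k l)]
    rfl
  simp only [sum_apply, h3, Finset.sum_add_distrib] at h2
  have h4 : ∑ l, g y q l * ∑ p, christoffel g j k p y * christoffel g i p l y =
      ∑ p, christoffel g j k p y *
        inner ℝ (fderiv ℝ (fderiv ℝ Ψ) y (e i) (e p)) (fderiv ℝ Ψ y (e q)) := by
    simp only [← h.sum_christoffel hy, Finset.mul_sum]
    rw [Finset.sum_comm]
    refine Finset.sum_congr rfl fun i _ => Finset.sum_congr rfl fun j _ => by ring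
  -- The tangential part of the second factor drops because the first factor is normal; only then is
  -- the first factor expanded.
  have h5 : inner ℝ (secondForm Ψ g y j k) (secondForm Ψ g y i q)
      = inner ℝ (fderiv ℝ (fderiv ℝ Ψ) y (e j) (e k)) (fderiv ℝ (fderiv ℝ Ψ) y (e i) (e q))
        - ∑ p, christoffel g j k p y *
          inner ℝ (fderiv ℝ Ψ y (e p)) (fderiv ℝ (fderiv ℝ Ψ) y (e i) (e q)) := by
    conv_lhs => rw [secondForm.eq_1 Ψ g y i q, inner_sub_right, inner_sum]
    simp only [real_inner_smul_right, h.inner_secondForm hy, mul_zero, Finset.sum_const_zero,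
      sub_zero]
    rw [secondForm, inner_sub_left, sum_inner]
    simp only [real_inner_smul_left]
  have h6 : ∑ l, christoffel g j k l y * pd i (fun z => g z q l) y =
      ∑ p, christoffel g j k p y *
        inner ℝ (fderiv ℝ (fderiv ℝ Ψ) y (e i) (e p)) (fderiv ℝ Ψ y (e q)) +
      ∑ p, christoffel g j k p y *
          inner ℝ (fderiv ℝ Ψ y (e p)) (fderiv ℝ (fderiv ℝ Ψ) y (e i) (e q)) := by
    rw [← Finset.sum_add_distrib]
    refine Finset.sum_congr rfl fun p _ => ?_
    rw [h.pd_metric hy, real_inner_comm (fderiv ℝ Ψ y (e p)),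
      real_inner_comm (fderiv ℝ Ψ y (e q))]
    ring
  simp only [mul_add, Finset.sum_add_distrib]
  rw [h4, h5]
  linarith

/-- The Gauss equation in coordinates. -/
lemma sum_curv (h : IsInducedMetric V Ψ g) {y : Euc m} (hy : y ∈ V) (i j k q : Fin m) :
    ∑ l, g y q l * curv g i j k l y =
      inner ℝ (secondForm Ψ g y j k) (secondForm Ψ g y i q)
      - inner ℝ (secondForm Ψ g y i k) (secondForm Ψ g y j q) := by
  have hk := contDiffAt_fderiv_const (h.smooth y hy) (e k)
  have h1 := h.sum_pd_christoffel hy i j k q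
  have h2 := h.sum_pd_christoffel hy j i k q
  rw [fderiv_fderiv_comm hk (e j) (e i)] at h2
  have h3 : ∑ l, g y q l * curv g i j k l y =
      ∑ l, g y q l * (pd i (christoffel g j k l) y
        + ∑ p, christoffel g j k p y * christoffel g i p l y) -
      ∑ l, g y q l * (pd j (christoffel g i k l) y
        + ∑ p, christoffel g i k p y * christoffel g j p l y) := by
    rw [← Finset.sum_sub_distrib]
    refine Finset.sum_congr rfl fun l _ => ?_
    rw [curv, Finset.sum_sub_distrib]
    ring
  rw [h3, h1, h2]
  ring

/-- The Gauss equation. -/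
lemma gauss (h : IsInducedMetric V Ψ g) {y : Euc m} (hy : y ∈ V) :
    ∃ (II : Euc m → Euc m → E) (c : Euc m → Euc m → Euc m),
      (∀ a b, II a b = fderiv ℝ (fderiv ℝ Ψ) y a b - fderiv ℝ Ψ y (c a b)) ∧
      (∀ a b v, inner ℝ (II a b) (fderiv ℝ Ψ y v) = 0) ∧
      ∀ a b, ip g y (curvVec g y a b b) a
        = inner ℝ (II b b) (II a a) - inner ℝ (II a b) (II a b) := by
  -- Symmetry is needed at the end, where the antisymmetrised formula produces ⟨II(a,b), II(b,a)⟩.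
  have hsymm : ∀ i j, secondForm Ψ g y i j = secondForm Ψ g y j i := by
    intro i j
    have : ∀ k, christoffel g i j k y = christoffel g j i k y := fun k => by
      unfold christoffel
      congr 1
      refine Finset.sum_congr rfl fun l _ => ?_
      have : pd l (fun z => g z i j) y = pd l (fun z => g z j i) y := by
        rw [h.pd_metric hy, h.pd_metric hy, real_inner_comm (fderiv ℝ Ψ y (e j)),
          real_inner_comm (fderiv ℝ Ψ y (e i)), add_comm]
      rw [this]; ring
    simp only [secondForm, this, fderiv_fderiv_comm (h.smooth y hy) (e i) (e j)]
  refine ⟨fun a b => ∑ i, ∑ j, (a i * b j) • secondForm Ψ g y i j,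
    fun a b => ∑ i, ∑ j, (a i * b j) • ∑ k, christoffel g i j k y • e k, ?_, ?_, ?_⟩
  · intro a b
    have : fderiv ℝ (fderiv ℝ Ψ) y a b
        = ∑ i, ∑ j, (a i * b j) • fderiv ℝ (fderiv ℝ Ψ) y (e i) (e j) := by
      conv_lhs => rw [← sum_smul_e a, ← sum_smul_e b]
      simp only [map_sum, map_smul, sum_apply, smul_apply,
        Finset.smul_sum, smul_smul]
      rw [Finset.sum_comm]
      refine Finset.sum_congr rfl fun i _ => Finset.sum_congr rfl fun j _ => by rw [mul_comm]
    rw [this]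
    simp only [secondForm, map_sum, map_smul, smul_sub, Finset.sum_sub_distrib]
  · intro a b v
    rw [← sum_smul_e v]
    simp only [map_sum, map_smul, sum_inner, inner_sum, real_inner_smul_left,
      real_inner_smul_right, h.inner_secondForm hy, mul_zero, Finset.sum_const_zero]
  · intro a b
    have h1 : ip g y (curvVec g y a b b) a = ∑ q, ∑ i, ∑ j, ∑ k,
        a q * a i * b j * b k * ∑ l, g y q l * curv g i j k l y := by
      rw [ip_eq_sum_sum_mul]
      refine Finset.sum_congr rfl fun q _ => ?_
      have hc : ∀ l, curvVec g y a b b l = ∑ i, ∑ j, ∑ k, curv g i j k l y * a i * b j * b k := by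
        intro l
        simp [curvVec, e, Finset.sum_apply, Pi.single_apply]
      simp only [hc, Finset.mul_sum, Finset.sum_mul]
      rw [Finset.sum_comm]
      refine Finset.sum_congr rfl fun i _ => ?_
      rw [Finset.sum_comm]
      refine Finset.sum_congr rfl fun j _ => ?_
      rw [Finset.sum_comm]
      refine Finset.sum_congr rfl fun k _ => Finset.sum_congr rfl fun l _ => ?_
      rw [h.symm hy l q]; ring
    rw [h1]
    simp only [h.sum_curv hy, sum_inner, inner_sum, real_inner_smul_left, real_inner_smul_right,
      mul_sub, Finset.sum_sub_distrib]
    congr 1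
    · rw [Finset.sum_comm]
      refine Finset.sum_congr rfl fun i _ => Finset.sum_congr rfl fun q _ =>
        Finset.sum_congr rfl fun j _ => Finset.sum_congr rfl fun k _ => by ring
    · rw [Finset.sum_comm]
      refine Finset.sum_congr rfl fun i _ => ?_
      rw [Finset.sum_comm_cycle]
      refine Finset.sum_congr rfl fun k _ => ?_
      refine Finset.sum_congr rfl fun q _ => Finset.sum_congr rfl fun j _ => ?_
      rw [hsymm j q, real_inner_comm]; ring

end IsInducedMetric
end Folds

namespace Folds

/-! ### Stereographic projection -/

section Stereo

variable {m : ℕ}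

/-- The inclusion of the hyperplane into the target of the inverse stereographic projection. -/
noncomputable def stereoIncl (m : ℕ) : Euc m →L[ℝ] WithLp 2 (Euc m × ℝ) :=
  ((WithLp.prodContinuousLinearEquiv 2 ℝ (Euc m) ℝ).symm : _ →L[ℝ] _).comp
    (ContinuousLinearMap.inl ℝ (Euc m) ℝ)

/-- The unit vector orthogonal to the hyperplane. -/
noncomputable def stereoNorth (m : ℕ) : WithLp 2 (Euc m × ℝ) := WithLp.toLp 2 (0, 1)

@[simp] lemma inner_stereoIncl (x y : Euc m) :
    inner ℝ (stereoIncl m x) (stereoIncl m y) = inner ℝ x y := by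
  simp [stereoIncl, WithLp.prod_inner_apply]

@[simp] lemma inner_stereoIncl_north (x : Euc m) :
    inner ℝ (stereoIncl m x) (stereoNorth m) = 0 := by
  simp [stereoIncl, stereoNorth]

@[simp] lemma inner_north_stereoIncl (x : Euc m) :
    inner ℝ (stereoNorth m) (stereoIncl m x) = 0 := by
  rw [real_inner_comm, inner_stereoIncl_north]

@[simp] lemma inner_north_north : inner ℝ (stereoNorth m) (stereoNorth m) = 1 := by
  simp [stereoNorth]

/-- The inverse stereographic projection onto the unit sphere with centre `stereoNorth m`. -/
noncomputable def stereo (x : Euc m) : WithLp 2 (Euc m × ℝ) :=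
  (2 / (1 + ‖x‖ ^ 2)) • (stereoIncl m x + stereoNorth m)

lemma one_add_norm_sq_pos (x : Euc m) : 0 < 1 + ‖x‖ ^ 2 := by positivity

lemma contDiff_stereo : ContDiff ℝ ∞ (stereo : Euc m → _) := by
  unfold stereo
  refine ContDiff.smul (contDiff_const.div (contDiff_const.add (contDiff_norm_sq ℝ))
    fun x => (one_add_norm_sq_pos x).ne') ?_
  exact (stereoIncl m).contDiff.add contDiff_const

lemma hasFDerivAt_two_div_one_add_norm_sq (x : Euc m) :
    HasFDerivAt (fun x : Euc m => 2 / (1 + ‖x‖ ^ 2))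
      (-(2 / (1 + ‖x‖ ^ 2)) ^ 2 • innerSL ℝ x) x := by
  have h1 : HasFDerivAt (fun x : Euc m => 1 + ‖x‖ ^ 2) (2 • innerSL ℝ x) x :=
    ((hasStrictFDerivAt_norm_sq x).hasFDerivAt).const_add 1
  have h0 := (one_add_norm_sq_pos x).ne'
  have h2 := ((hasDerivAt_inv h0).comp_hasFDerivAt x h1).const_mul 2
  simp only [Function.comp_def, ← div_eq_mul_inv] at h2
  refine h2.congr_fderiv ?_
  ext u
  simp only [smul_apply, innerSL_apply_apply, smul_eq_mul, nsmul_eq_mul]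
  field_simp
  norm_num

lemma fderiv_smul_affine {F G : Type*} [NormedAddCommGroup F] [NormedSpace ℝ F]
    [NormedAddCommGroup G] [NormedSpace ℝ G] (I : F →L[ℝ] G) (N : G) {c : F → ℝ} {c' : F →L[ℝ] ℝ}
    {x : F} (hc : HasFDerivAt c c' x) (u : F) :
    fderiv ℝ (fun x => c x • (I x + N)) x u = c x • I u + c' u • (I x + N) := by
  have h : HasFDerivAt (fun x => c x • (I x + N)) (c x • I + c'.smulRight (I x + N)) x :=
    hc.smul (I.hasFDerivAt.add_const N)
  rw [h.fderiv]
  rfl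

lemma fderiv_stereo (x u : Euc m) :
    fderiv ℝ stereo x u = (2 / (1 + ‖x‖ ^ 2)) • stereoIncl m u
      - ((2 / (1 + ‖x‖ ^ 2)) ^ 2 * inner ℝ x u) • (stereoIncl m x + stereoNorth m) := by
  have h := fderiv_smul_affine (stereoIncl m) (stereoNorth m)
    (hasFDerivAt_two_div_one_add_norm_sq x) u
  have h1 : (-(2 / (1 + ‖x‖ ^ 2)) ^ 2 • innerSL ℝ x) u
      = -((2 / (1 + ‖x‖ ^ 2)) ^ 2 * inner ℝ x u) := by simp
  rw [h1, neg_smul, ← sub_eq_add_neg] at h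
  exact h

/-- The terms in ⟨x,u⟩⟨x,w⟩ cancel because ‖x + N‖² = 1 + r² for the unit normal N. The remaining
factor is that of the spherical metric, so `stereo` is isometric. -/
lemma inner_fderiv_stereo (x u w : Euc m) :
    inner ℝ (fderiv ℝ stereo x u) (fderiv ℝ stereo x w)
      = (2 / (1 + ‖x‖ ^ 2)) ^ 2 * inner ℝ u w := by
  rw [fderiv_stereo, fderiv_stereo]
  simp only [inner_sub_left, inner_sub_right, inner_add_left, inner_add_right,
    real_inner_smul_left, real_inner_smul_right, inner_stereoIncl, inner_stereoIncl_north,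
    inner_north_stereoIncl, inner_north_north]
  simp only [real_inner_self_eq_norm_sq x]
  rw [real_inner_comm x u]
  have h0 := (one_add_norm_sq_pos x).ne'
  field_simp
  ring

/-- `stereo` is the inversion Y ↦ 2Y/‖Y‖² applied to the hyperplane at height one; its image lies on
the unit sphere through the origin with centre `stereoNorth`. -/
lemma inner_stereo_sub_north (x : Euc m) :
    inner ℝ (stereo x - stereoNorth m) (stereo x - stereoNorth m) = 1 := by
  rw [stereo]
  simp only [inner_sub_left, inner_sub_right, inner_add_left, inner_add_right,
    real_inner_smul_left, real_inner_smul_right, inner_stereoIncl, inner_stereoIncl_north,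
    inner_north_stereoIncl, inner_north_north]
  simp only [real_inner_self_eq_norm_sq x]
  have h0 := (one_add_norm_sq_pos x).ne'
  field_simp
  ring

lemma inner_fderiv_stereo_radial (x u : Euc m) :
    inner ℝ (fderiv ℝ stereo x u) (stereo x - stereoNorth m) = 0 := by
  rw [fderiv_stereo, stereo]
  simp only [inner_sub_left, inner_sub_right, inner_add_left, inner_add_right,
    real_inner_smul_left, real_inner_smul_right, inner_stereoIncl, inner_stereoIncl_north,
    inner_north_stereoIncl, inner_north_north]
  simp only [real_inner_self_eq_norm_sq x]
  rw [real_inner_comm x u]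
  have h0 := (one_add_norm_sq_pos x).ne'
  field_simp
  ring

lemma ip_sphericalMetric (x u w : Euc m) :
    ip sphericalMetric x u w = (2 / (1 + ‖x‖ ^ 2)) ^ 2 * inner ℝ u w := by
  simp only [ip, sphericalMetric, Matrix.smul_apply, Matrix.one_apply, smul_eq_mul, mul_ite,
    mul_one, mul_zero, ite_mul, zero_mul, Finset.sum_ite_eq, Finset.mem_univ, if_true]
  rw [PiLp.inner_apply, Finset.mul_sum]
  refine Finset.sum_congr rfl fun i _ => ?_
  simp only [RCLike.inner_apply, conj_trivial]
  field_simp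
  ring

end Stereo

/-! ### Normal vectors in codimension two. -/

section NormalSpace

variable {E : Type*} [NormedAddCommGroup E] [InnerProductSpace ℝ E]

/-- In codimension two, inner products of normal vectors are computed by an orthogonal basis of the
normal space. -/
lemma inner_eq_of_normal [FiniteDimensional ℝ E] {T : Type*} [AddCommGroup T] [Module ℝ T] [FiniteDimensional ℝ T]
    (L : T →ₗ[ℝ] E) (hL : Function.Injective L)
    (hdim : Module.finrank ℝ E = Module.finrank ℝ T + 2) {P N : E} {μ : ℝ}
    (hμ : μ ≠ 0) (hP : inner ℝ P P = 1) (hN : inner ℝ N N = μ) (hPN : inner ℝ P N = 0)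
    (hLP : ∀ a, inner ℝ (L a) P = 0) (hLN : ∀ a, inner ℝ (L a) N = 0)
    {X Y : E} (hX : ∀ a, inner ℝ X (L a) = 0) :
    inner ℝ X Y = inner ℝ X P * inner ℝ Y P + inner ℝ X N * inner ℝ Y N / μ := by
  -- Tangent space, P and N together fill E: the map is injective by orthogonality, hence onto by
  -- the dimension count. The tangential component of Y is then invisible to the normal vector X.
  let Φ : T × ℝ × ℝ →ₗ[ℝ] E :=
    L.coprod ((LinearMap.toSpanSingleton ℝ E P).coprod (LinearMap.toSpanSingleton ℝ E N))
  have hΦ : ∀ a s t, Φ (a, s, t) = L a + (s • P + t • N) := fun a s t => by simp [Φ]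
  have hNP : inner ℝ N P = 0 := by rw [real_inner_comm, hPN]
  have hinj : Function.Injective Φ := by
    rw [← LinearMap.ker_eq_bot, LinearMap.ker_eq_bot']
    rintro ⟨a, s, t⟩ h
    rw [hΦ] at h
    have h1 := congrArg (fun v => inner ℝ v P) h
    have h2 := congrArg (fun v => inner ℝ v N) h
    simp only [inner_add_left, real_inner_smul_left, hLP, hLN, hP, hN, hPN, hNP,
      inner_zero_left] at h1 h2
    have hs : s = 0 := by linarith
    have ht : t = 0 := by
      have : t * μ = 0 := by linarith
      exact (mul_eq_zero.mp this).resolve_right hμ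
    subst hs ht
    have : L a = 0 := by simpa using h
    have ha : a = 0 := hL (this.trans (map_zero L).symm)
    simp [ha]
  have hsurj : Function.Surjective Φ :=
    (LinearMap.injective_iff_surjective_of_finrank_eq_finrank (by simp [hdim])).mp hinj
  obtain ⟨⟨a, s, t⟩, h⟩ := hsurj Y
  rw [← h, hΦ]
  simp only [inner_add_left, inner_add_right, real_inner_smul_left, real_inner_smul_right, hLP, hLN,
    hP, hN, hPN, hNP, hX]
  field_simp
  ring

/-- The second derivative in a normal direction. -/
lemma inner_fderiv_fderiv {m : ℕ} {V : Set (Euc m)} {Ψ : Euc m → E} {g : Coeffs m}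
    (h : IsInducedMetric V Ψ g) (B : E →L[ℝ] E) (c : E) (a : Euc m)
    (hB : ∀ z ∈ V, inner ℝ (fderiv ℝ Ψ z a) (B (Ψ z) - c) = 0) {y : Euc m} (hy : y ∈ V)
    (b : Euc m) : inner ℝ (fderiv ℝ (fderiv ℝ Ψ) y b a) (B (Ψ y) - c)
      = -inner ℝ (fderiv ℝ Ψ y a) (B (fderiv ℝ Ψ y b)) := by
  have hs := h.smooth y hy
  have hd : DifferentiableAt ℝ Ψ y := hs.differentiableAt (by simp)
  -- Orthogonality holds on all of V, so it may be differentiated along b; as B is linear, the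
  -- normal field has derivative B(dΨ b).
  have h0 : (fun z => inner ℝ (fderiv ℝ Ψ z a) (B (Ψ z) - c)) =ᶠ[nhds y] fun _ => (0 : ℝ) :=
    Filter.eventuallyEq_of_mem (h.isOpen.mem_nhds hy) hB
  have h1 := congrArg (fun L : Euc m →L[ℝ] ℝ => L b) h0.fderiv_eq
  beta_reduce at h1
  have hB' : HasFDerivAt (fun z => B (Ψ z) - c) (B.comp (fderiv ℝ Ψ y)) y :=
    (B.hasFDerivAt.comp y hd.hasFDerivAt).sub_const c
  rw [fderiv_inner_apply ℝ ((contDiffAt_fderiv_const hs _).differentiableAt (by simp))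
    hB'.differentiableAt, fderiv_fderiv_const hs, hB'.fderiv] at h1
  simp at h1
  linarith

end NormalSpace
end Folds

namespace Folds

/-! ### The folds in the sphere

Under the inverse stereographic projection, the set `x_{n+1}² = λ² x_1` becomes a quadratic cone. -/

section Cone

variable {E : Type*} [NormedAddCommGroup E] [InnerProductSpace ℝ E]

/-- Half of the Hessian of `Y ↦ 2 (⟪q, Y⟫² - λ² ⟪p, Y⟫ ⟪N, Y⟫)`. -/
noncomputable def coneOp (lam : ℝ) (p q N : E) : E →L[ℝ] E :=
  (2 : ℝ) • (innerSL ℝ q).smulRight q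
    - (lam ^ 2) • ((innerSL ℝ N).smulRight p + (innerSL ℝ p).smulRight N)

lemma coneOp_apply (lam : ℝ) (p q N Y : E) : coneOp lam p q N Y =
    (2 * inner ℝ q Y) • q - (lam ^ 2 * inner ℝ N Y) • p - (lam ^ 2 * inner ℝ p Y) • N := by
  have : coneOp lam p q N Y = (2 : ℝ) • inner ℝ q Y • q
    - (lam ^ 2) • (inner ℝ N Y • p + inner ℝ p Y • N) := rfl
  rw [this]
  module

end Cone

variable {n : ℕ}

@[simp] lemma e_apply {m : ℕ} (i j : Fin m) : (e i : Euc m) j = if j = i then 1 else 0 := by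
  simp [e]

@[simp] lemma inner_e_right {m : ℕ} (x : Euc m) (i : Fin m) : inner ℝ x (e i) = x i := by
  simp [e, EuclideanSpace.inner_single_right]

@[simp] lemma inner_e_left {m : ℕ} (x : Euc m) (i : Fin m) : inner ℝ (e i) x = x i := by
  rw [real_inner_comm, inner_e_right]

/-- The operator of the cone over the image of `x_{n+1}² = λ² x_1`. -/
noncomputable def foldOp (n : ℕ) (lam : ℝ) :
    WithLp 2 (Euc (n + 1) × ℝ) →L[ℝ] WithLp 2 (Euc (n + 1) × ℝ) :=
  coneOp lam (stereoIncl _ (e 0)) (stereoIncl _ (e (Fin.last n))) (stereoNorth _)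

lemma foldOp_stereo (lam : ℝ) (x : Euc (n + 1)) :
    foldOp n lam (stereo x) = (2 / (1 + ‖x‖ ^ 2)) •
      ((2 * x (Fin.last n)) • stereoIncl _ (e (Fin.last n)) - lam ^ 2 • stereoIncl _ (e 0)
        - (lam ^ 2 * x 0) • stereoNorth _) := by
  rw [foldOp, coneOp_apply, stereo]
  simp only [inner_add_right, real_inner_smul_right, inner_stereoIncl, inner_stereoIncl_north,
    inner_north_stereoIncl, inner_north_north, inner_e_left]
  module

lemma foldOp_fderiv_stereo (lam : ℝ) (x w : Euc (n + 1)) :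
    foldOp n lam (fderiv ℝ stereo x w) =
      (2 / (1 + ‖x‖ ^ 2)) • ((2 * w (Fin.last n)) • stereoIncl _ (e (Fin.last n))
        - (lam ^ 2 * w 0) • stereoNorth _)
      - ((2 / (1 + ‖x‖ ^ 2)) ^ 2 * inner ℝ x w) •
      ((2 * x (Fin.last n)) • stereoIncl _ (e (Fin.last n)) - lam ^ 2 • stereoIncl _ (e 0)
        - (lam ^ 2 * x 0) • stereoNorth _) := by
  rw [foldOp, coneOp_apply, fderiv_stereo]
  simp only [inner_add_right, inner_sub_right, real_inner_smul_right, inner_stereoIncl,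
    inner_stereoIncl_north, inner_north_stereoIncl, inner_north_north, inner_e_left]
  module

/-- The derivative of `stereo` has a component along Y = `stereo x`, whose pairing with `foldOp` of
Y is twice the quadratic form at Y, zero by `hx`. What remains is a multiple of dF_λ(u), so `foldOp`
of Y is normal to the fold. -/
lemma inner_fderiv_stereo_foldOp {lam : ℝ} {x : Euc (n + 1)}
    (hx : x (Fin.last n) ^ 2 = lam ^ 2 * x 0) (u : Euc (n + 1)) :
    inner ℝ (fderiv ℝ stereo x u) (foldOp n lam (stereo x)) = (2 / (1 + ‖x‖ ^ 2)) ^ 2 *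
      (2 * x (Fin.last n) * u (Fin.last n) - lam ^ 2 * u 0) := by
  rw [foldOp_stereo, fderiv_stereo]
  simp only [inner_add_left, inner_sub_right, inner_sub_left, real_inner_smul_right,
    real_inner_smul_left, inner_stereoIncl, inner_stereoIncl_north, inner_north_stereoIncl,
    inner_north_north, inner_e_right]
  linear_combination (-2 * (2 / (1 + ‖x‖ ^ 2)) ^ 3 * inner ℝ x u) * hx

/-- All terms involving Y vanish, the pure one by `hx` and the mixed ones by tangency of u and w. On
vectors without component along `stereoNorth` the quadratic form sees only the last coordinates. -/
lemma inner_fderiv_stereo_foldOp_fderiv {lam : ℝ} {x u w : Euc (n + 1)}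
    (hx : x (Fin.last n) ^ 2 = lam ^ 2 * x 0)
    (hu : 2 * x (Fin.last n) * u (Fin.last n) = lam ^ 2 * u 0)
    (hw : 2 * x (Fin.last n) * w (Fin.last n) = lam ^ 2 * w 0) :
    inner ℝ (fderiv ℝ stereo x u) (foldOp n lam (fderiv ℝ stereo x w)) =
      (2 / (1 + ‖x‖ ^ 2)) ^ 2 * (2 * u (Fin.last n) * w (Fin.last n)) := by
  rw [foldOp_fderiv_stereo, fderiv_stereo]
  simp only [inner_add_left, inner_sub_right, inner_sub_left, real_inner_smul_right,
    real_inner_smul_left, inner_stereoIncl, inner_stereoIncl_north, inner_north_stereoIncl,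
    inner_north_north, inner_e_right]
  linear_combination (2 * (2 / (1 + ‖x‖ ^ 2)) ^ 4 * inner ℝ x u * inner ℝ x w) * hx
    - (2 / (1 + ‖x‖ ^ 2)) ^ 3 * inner ℝ x w * hu - (2 / (1 + ‖x‖ ^ 2)) ^ 3 * inner ℝ x u * hw

/-- On the cone Y is orthogonal to its `foldOp`, so only the pairing with the centre survives. It is
nonzero where x_1 ≠ 0, which is why the cone normal must be orthogonalised against the radial one.
-/
lemma inner_radial_foldOp {lam : ℝ} {x : Euc (n + 1)}
    (hx : x (Fin.last n) ^ 2 = lam ^ 2 * x 0) :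
    inner ℝ (stereo x - stereoNorth _) (foldOp n lam (stereo x))
      = lam ^ 2 * (2 / (1 + ‖x‖ ^ 2)) * x 0 := by
  rw [foldOp_stereo, stereo]
  simp only [inner_add_left, inner_sub_right, inner_sub_left, real_inner_smul_right,
    real_inner_smul_left, inner_stereoIncl, inner_stereoIncl_north, inner_north_stereoIncl,
    inner_north_north, inner_e_right]
  linear_combination (2 * (2 / (1 + ‖x‖ ^ 2)) ^ 2) * hx

lemma inner_foldOp_self [NeZero n] {lam : ℝ} {x : Euc (n + 1)}
    (hx : x (Fin.last n) ^ 2 = lam ^ 2 * x 0) :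
    inner ℝ (foldOp n lam (stereo x)) (foldOp n lam (stereo x))
      = (2 / (1 + ‖x‖ ^ 2)) ^ 2 * (lam ^ 4 + 4 * lam ^ 2 * x 0 + lam ^ 4 * x 0 ^ 2) := by
  have h1 : ¬ (Fin.last n = 0) := by simpa using NeZero.ne n
  have h2 : ¬ (0 = Fin.last n) := fun h => h1 h.symm
  rw [foldOp_stereo]
  simp only [inner_sub_right, inner_sub_left, real_inner_smul_right,
    real_inner_smul_left, inner_stereoIncl, inner_stereoIncl_north, inner_north_stereoIncl,
    inner_north_north, inner_e_right, e_apply, h1, h2, if_true, if_false]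
  linear_combination (4 * (2 / (1 + ‖x‖ ^ 2)) ^ 2) * hx

/-- The restriction of the Hessian of `F_λ` to the tangent space of the fold. -/
noncomputable def foldHess (lam : ℝ) (q u w : Euc (n + 1)) : ℝ :=
  2 * u (Fin.last n) * w (Fin.last n) - 2 * lam ^ 2 * q 0 / (1 + ‖q‖ ^ 2) * inner ℝ u w

/-- The sectional curvature of the fold, according to the Gauss equation. -/
noncomputable def foldSec (lam : ℝ) (q u w : Euc (n + 1)) : ℝ :=
  1 + (1 + ‖q‖ ^ 2) ^ 2 * (foldHess lam q u u * foldHess lam q w w - foldHess lam q u w ^ 2) /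
    (4 * (lam ^ 4 + 4 * lam ^ 2 * q 0) * (inner ℝ u u * inner ℝ w w - inner ℝ u w ^ 2))

/-- `ψ` is a smooth immersion of the open set `V` into the set `x_{n+1}² = λ² x_1`. -/
structure IsFoldImmersion (lam : ℝ) (V : Set (Euc n)) (ψ : Euc n → Euc (n + 1)) : Prop where
  isOpen : IsOpen V
  smooth : ∀ y ∈ V, ContDiffAt ℝ ∞ ψ y
  immersion : ∀ y ∈ V, Function.Injective (fderiv ℝ ψ y)
  mem : ∀ y ∈ V, ψ y (Fin.last n) ^ 2 = lam ^ 2 * ψ y 0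

lemma hasFDerivAt_coord {F : Type*} [NormedAddCommGroup F] [NormedSpace ℝ F] {m : ℕ}
    {ψ : F → Euc m} {y : F} (h : DifferentiableAt ℝ ψ y) (i : Fin m) :
    HasFDerivAt (fun z => ψ z i) ((EuclideanSpace.proj i : Euc m →L[ℝ] ℝ).comp (fderiv ℝ ψ y)) y :=
  (EuclideanSpace.proj i : Euc m →L[ℝ] ℝ).hasFDerivAt.comp y h.hasFDerivAt

namespace IsFoldImmersion

variable {lam : ℝ} {V : Set (Euc n)} {ψ : Euc n → Euc (n + 1)}

lemma tangent (h : IsFoldImmersion lam V ψ) {y : Euc n} (hy : y ∈ V) (a : Euc n) :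
    2 * ψ y (Fin.last n) * fderiv ℝ ψ y a (Fin.last n) = lam ^ 2 * fderiv ℝ ψ y a 0 := by
  have hd : DifferentiableAt ℝ ψ y := (h.smooth y hy).differentiableAt (by simp)
  have h1 := (hasFDerivAt_coord hd (Fin.last n)).pow 2
  have h2 := (hasFDerivAt_coord hd 0).const_mul (lam ^ 2)
  have h3 : (fun z => ψ z (Fin.last n) ^ 2) =ᶠ[nhds y] fun z => lam ^ 2 * ψ z 0 :=
    Filter.eventuallyEq_of_mem (h.isOpen.mem_nhds hy) h.mem
  have h4 := congrArg (fun L : Euc n →L[ℝ] ℝ => L a) h3.fderiv_eq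
  beta_reduce at h4
  rw [HasFDerivAt.fderiv h1, HasFDerivAt.fderiv h2] at h4
  simpa using h4

lemma fderiv_stereo_comp (h : IsFoldImmersion lam V ψ) {y : Euc n} (hy : y ∈ V) (a : Euc n) :
    fderiv ℝ (fun z => stereo (ψ z)) y a = fderiv ℝ stereo (ψ y) (fderiv ℝ ψ y a) := by
  have hd : DifferentiableAt ℝ ψ y := (h.smooth y hy).differentiableAt (by simp)
  have hs : DifferentiableAt ℝ (stereo : Euc (n + 1) → _) (ψ y) :=
    contDiff_stereo.contDiffAt.differentiableAt (by simp)
  have := fderiv_comp y hs hd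
  exact congrArg (fun L => L a) this

lemma isInducedMetric (h : IsFoldImmersion lam V ψ) :
    IsInducedMetric V (fun z => stereo (ψ z)) (pullback sphericalMetric ψ) where
  isOpen := h.isOpen
  smooth y hy := contDiff_stereo.contDiffAt.comp y (h.smooth y hy)
  immersion y hy := by
    rw [injective_iff_map_eq_zero]
    intro a ha
    rw [h.fderiv_stereo_comp hy] at ha
    have h1 := inner_fderiv_stereo (ψ y) (fderiv ℝ ψ y a) (fderiv ℝ ψ y a)
    rw [ha, inner_zero_left] at h1
    have h2 : (2 / (1 + ‖ψ y‖ ^ 2)) ^ 2 ≠ 0 :=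
      pow_ne_zero _ (div_ne_zero two_ne_zero (one_add_norm_sq_pos _).ne')
    have h3 := inner_self_eq_zero.mp ((mul_eq_zero.mp h1.symm).resolve_left h2)
    exact (injective_iff_map_eq_zero _).mp (h.immersion y hy) a h3
  eq_inner y hy i j := by
    rw [h.fderiv_stereo_comp hy, h.fderiv_stereo_comp hy, inner_fderiv_stereo, ← ip_sphericalMetric]
    rfl

/-- The Gauss equation for an immersion into `x_{n+1}² = λ² x_1` with the spherical metric. -/
lemma coordSec_eq [NeZero n] (h : IsFoldImmersion lam V ψ) (hlam : lam ≠ 0) {y : Euc n}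
    (hy : y ∈ V) (a b : Euc n)
    (hD : inner ℝ (fderiv ℝ ψ y a) (fderiv ℝ ψ y a) * inner ℝ (fderiv ℝ ψ y b) (fderiv ℝ ψ y b)
      - inner ℝ (fderiv ℝ ψ y a) (fderiv ℝ ψ y b) ^ 2 ≠ 0) :
    coordSec (pullback sphericalMetric ψ) y a b
      = foldSec lam (ψ y) (fderiv ℝ ψ y a) (fderiv ℝ ψ y b) := by
  have hg := h.isInducedMetric
  have hx := h.mem y hy
  set x := ψ y with hxdef
  set Z := 2 / (1 + ‖x‖ ^ 2) with hZ
  have hs0 := (one_add_norm_sq_pos x).ne'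
  have hZ0 : Z ≠ 0 := div_ne_zero two_ne_zero hs0
  have hx0 : 0 ≤ x 0 := by
    by_contra hneg
    have : lam ^ 2 * x 0 < 0 := mul_neg_of_pos_of_neg (by positivity) (not_le.mp hneg)
    nlinarith [sq_nonneg (x (Fin.last n))]
  have hμ0 : 0 < lam ^ 4 + 4 * lam ^ 2 * x 0 := by positivity
  obtain ⟨II, c, hII, hperp, hgauss⟩ := hg.gauss hy
  set P := stereo x - stereoNorth _ with hP
  set A := foldOp n lam (stereo x) with hA
  have hip : ∀ a b, ip (pullback sphericalMetric ψ) y a b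
      = Z ^ 2 * inner ℝ (fderiv ℝ ψ y a) (fderiv ℝ ψ y b) := fun a b => by
    rw [hg.ip_eq hy, h.fderiv_stereo_comp hy, h.fderiv_stereo_comp hy, inner_fderiv_stereo]
  have hPA : inner ℝ P A = lam ^ 2 * Z * x 0 := inner_radial_foldOp hx
  have hAP : inner ℝ A P = lam ^ 2 * Z * x 0 := by rw [real_inner_comm, hPA]
  have hPP : inner ℝ P P = 1 := inner_stereo_sub_north x
  have hTP : ∀ z ∈ V, ∀ a, inner ℝ (fderiv ℝ (fun z => stereo (ψ z)) z a)
      ((ContinuousLinearMap.id ℝ _) (stereo (ψ z)) - stereoNorth _) = 0 := fun z hz a => by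
    rw [h.fderiv_stereo_comp hz]
    exact inner_fderiv_stereo_radial _ _
  have hTA : ∀ z ∈ V, ∀ a, inner ℝ (fderiv ℝ (fun z => stereo (ψ z)) z a)
      (foldOp n lam (stereo (ψ z)) - 0) = 0 := fun z hz a => by
    rw [h.fderiv_stereo_comp hz, sub_zero, inner_fderiv_stereo_foldOp (h.mem z hz), h.tangent hz, sub_self,
      mul_zero]
  have hTPy : ∀ a, inner ℝ (fderiv ℝ (fun z => stereo (ψ z)) y a) P = 0 := hTP y hy
  have hTAy : ∀ a, inner ℝ (fderiv ℝ (fun z => stereo (ψ z)) y a) A = 0 := fun a => by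
    simpa using hTA y hy a
  -- The radial component is minus the induced metric; in the Gauss equation it produces exactly the
  -- summand 1.
  have hIIP : ∀ a b, inner ℝ (II a b) P
      = -(Z ^ 2 * inner ℝ (fderiv ℝ ψ y a) (fderiv ℝ ψ y b)) := fun a b => by
    have := inner_fderiv_fderiv hg (ContinuousLinearMap.id ℝ _) (stereoNorth _) b
      (fun z hz => hTP z hz b) hy a
    rw [hII, inner_sub_left, hTPy, sub_zero]
    refine this.trans ?_
    rw [h.fderiv_stereo_comp hy, h.fderiv_stereo_comp hy, ContinuousLinearMap.id_apply, inner_fderiv_stereo,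
      real_inner_comm]
  have hIIA : ∀ a b, inner ℝ (II a b) A = -(Z ^ 2 *
      (2 * fderiv ℝ ψ y a (Fin.last n) * fderiv ℝ ψ y b (Fin.last n))) := fun a b => by
    have := inner_fderiv_fderiv hg (foldOp n lam) 0 b (fun z hz => hTA z hz b) hy a
    rw [hII, inner_sub_left, hTAy, sub_zero]
    rw [sub_zero] at this
    refine this.trans ?_
    rw [h.fderiv_stereo_comp hy, h.fderiv_stereo_comp hy,
      inner_fderiv_stereo_foldOp_fderiv hx (h.tangent hy b) (h.tangent hy a)]
    ring
  -- Gram–Schmidt with the unit vector P, using `hPA`.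
  set N := A - (lam ^ 2 * Z * x 0) • P with hN
  have hPN : inner ℝ P N = 0 := by
    rw [hN, inner_sub_right, real_inner_smul_right, hPA, hPP]; ring
  have hNN : inner ℝ N N = Z ^ 2 * (lam ^ 4 + 4 * lam ^ 2 * x 0) := by
    have hAA : inner ℝ A A = Z ^ 2 * (lam ^ 4 + 4 * lam ^ 2 * x 0 + lam ^ 4 * x 0 ^ 2) :=
      inner_foldOp_self hx
    rw [hN]
    simp only [inner_sub_right, inner_sub_left, real_inner_smul_right, real_inner_smul_left, hPA,
      hAP, hPP, hAA]
    ring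
  -- The multiple of P subtracted from A supplies the metric term of `foldHess`.
  have hIIN : ∀ a b, inner ℝ (II a b) N
      = -(Z ^ 2 * foldHess lam x (fderiv ℝ ψ y a) (fderiv ℝ ψ y b)) := fun a b => by
    rw [hN, inner_sub_right, real_inner_smul_right, hIIA, hIIP, foldHess]
    rw [hZ]; ring
  have hnormal : ∀ a b a' b', inner ℝ (II a b) (II a' b')
      = inner ℝ (II a b) P * inner ℝ (II a' b') P + inner ℝ (II a b) N * inner ℝ (II a' b') N /
        (Z ^ 2 * (lam ^ 4 + 4 * lam ^ 2 * x 0)) := fun a b a' b' => by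
    refine inner_eq_of_normal (fderiv ℝ (fun z => stereo (ψ z)) y).toLinearMap
      (hg.immersion y hy) ?_ (by positivity) hPP hNN hPN hTPy (fun a => ?_) (hperp a b)
    · have : Module.finrank ℝ (WithLp 2 (Euc (n + 1) × ℝ))
        = Module.finrank ℝ (Euc (n + 1) × ℝ) :=
        (WithLp.linearEquiv 2 ℝ (Euc (n + 1) × ℝ)).finrank_eq
      rw [this]; simp
    · change inner ℝ (fderiv ℝ (fun z => stereo (ψ z)) y a) N = 0
      rw [hN, inner_sub_right, real_inner_smul_right, hTAy, hTPy]; ring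
  rw [coordSec, hgauss, hnormal, hnormal, hip, hip, hip]
  simp only [hIIP, hIIN, foldSec]
  have h4 : (1 + ‖x‖ ^ 2) = 2 / Z := by rw [hZ]; field_simp
  rw [h4]
  -- What is left is a rational identity in the Gram and Hessian entries.
  generalize inner ℝ (fderiv ℝ ψ y a) (fderiv ℝ ψ y a) = g11 at *
  generalize inner ℝ (fderiv ℝ ψ y b) (fderiv ℝ ψ y b) = g22 at *
  generalize inner ℝ (fderiv ℝ ψ y a) (fderiv ℝ ψ y b) = g12 at *
  generalize foldHess lam x (fderiv ℝ ψ y a) (fderiv ℝ ψ y a) = k11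
  generalize foldHess lam x (fderiv ℝ ψ y b) (fderiv ℝ ψ y b) = k22
  generalize foldHess lam x (fderiv ℝ ψ y a) (fderiv ℝ ψ y b) = k12
  have h5 : Z ^ 2 * g11 * (Z ^ 2 * g22) - (Z ^ 2 * g12) ^ 2 = Z ^ 4 * (g11 * g22 - g12 ^ 2) := by
    ring
  rw [h5]
  generalize hDD : g11 * g22 - g12 ^ 2 = D at *
  have hμ := hμ0.ne'
  generalize lam ^ 4 + 4 * lam ^ 2 * x 0 = μ at *
  rw [div_eq_iff (by positivity)]
  field_simp
  linear_combination 4 * Z ^ 2 * μ * hDD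

end IsFoldImmersion
end Folds

namespace Folds

/-! ### The global chart of the fold over `x_1 ≥ 0` -/

variable {n : ℕ}

lemma continuous_proj : Continuous (proj : Euc (n + 1) → Euc n) :=
  (PiLp.continuous_toLp 2 _).comp (continuous_pi fun i => by fun_prop)

lemma ext_lastCases {v w : Euc (n + 1)} (h1 : v (Fin.last n) = w (Fin.last n))
    (h2 : ∀ i : Fin n, v i.castSucc = w i.castSucc) : v = w := by
  ext i
  induction i using Fin.lastCases with
  | last => exact h1
  | cast i => exact h2 i

variable [NeZero n]

/-- The parametrization `y ↦ (y_1² / λ², y_2, ..., y_n, y_1)` of the set `x_{n+1}² = λ² x_1`. -/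
noncomputable def foldChart (lam : ℝ) (y : Euc n) : Euc (n + 1) :=
  WithLp.toLp 2 (Fin.lastCases (y 0) fun i => if i = 0 then y 0 ^ 2 / lam ^ 2 else y i)

/-- The linear left inverse of `foldChart`. -/
noncomputable def foldCoord (q : Euc (n + 1)) : Euc n :=
  WithLp.toLp 2 fun i => if i = 0 then q (Fin.last n) else q i.castSucc

@[simp] lemma foldChart_last (lam : ℝ) (y : Euc n) : foldChart lam y (Fin.last n) = y 0 := by
  simp [foldChart]

@[simp] lemma foldChart_castSucc (lam : ℝ) (y : Euc n) (i : Fin n) :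
    foldChart lam y i.castSucc = if i = 0 then y 0 ^ 2 / lam ^ 2 else y i := by
  simp [foldChart]

@[simp] lemma foldCoord_apply (q : Euc (n + 1)) (i : Fin n) :
    foldCoord q i = if i = 0 then q (Fin.last n) else q i.castSucc := rfl

lemma foldCoord_foldChart (lam : ℝ) (y : Euc n) : foldCoord (foldChart lam y) = y := by
  ext i
  by_cases h : i = 0 <;> simp [h]

lemma foldChart_foldCoord {lam : ℝ} (hlam : lam ≠ 0) {q : Euc (n + 1)}
    (hq : q (Fin.last n) ^ 2 = lam ^ 2 * q 0) : foldChart lam (foldCoord q) = q := by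
  refine ext_lastCases (by simp) fun i => ?_
  by_cases h : i = 0
  · subst h
    rw [foldChart_castSucc, if_pos rfl, foldCoord_apply, if_pos rfl, hq, Fin.castSucc_zero']
    field_simp
  · simp [h]

lemma contDiff_foldChart (lam : ℝ) : ContDiff ℝ ∞ (foldChart lam : Euc n → Euc (n + 1)) := by
  rw [contDiff_euclidean]
  intro i
  induction i using Fin.lastCases with
  | last => simp only [foldChart_last]; fun_prop
  | cast i =>
    simp only [foldChart_castSucc]
    by_cases h : i = 0
    · simp only [h, if_true]; fun_prop
    · simp only [h, if_false]; fun_prop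

lemma continuous_foldCoord : Continuous (foldCoord : Euc (n + 1) → Euc n) := by
  refine (PiLp.continuous_toLp 2 _).comp (continuous_pi fun i => ?_)
  by_cases h : i = 0
  · simp only [h, if_true]; fun_prop
  · simp only [h, if_false]; fun_prop

lemma fderiv_coord {F : Type*} [NormedAddCommGroup F] [NormedSpace ℝ F] {m : ℕ}
    {ψ : F → Euc m} {y : F} (h : DifferentiableAt ℝ ψ y) (a : F) (i : Fin m) :
    fderiv ℝ ψ y a i = fderiv ℝ (fun z => ψ z i) y a := by
  rw [(hasFDerivAt_coord h i).fderiv]; rfl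

lemma fderiv_apply_coord {m : ℕ} (i : Fin m) (y a : Euc m) :
    fderiv ℝ (fun z : Euc m => z i) y a = a i :=
  congrArg (fun L : Euc m →L[ℝ] ℝ => L a)
    (EuclideanSpace.proj i : Euc m →L[ℝ] ℝ).hasFDerivAt.fderiv

lemma hasFDerivAt_apply {m : ℕ} (i : Fin m) (y : Euc m) :
    HasFDerivAt (F := ℝ) (fun z : Euc m => z i) (EuclideanSpace.proj i : Euc m →L[ℝ] ℝ) y :=
  (EuclideanSpace.proj i : Euc m →L[ℝ] ℝ).hasFDerivAt

lemma fderiv_foldChart_last (lam : ℝ) (y a : Euc n) :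
    fderiv ℝ (foldChart lam) y a (Fin.last n) = a 0 := by
  rw [fderiv_coord ((contDiff_foldChart lam).contDiffAt.differentiableAt (by simp))]
  simp only [foldChart_last]
  exact fderiv_apply_coord 0 y a

lemma fderiv_foldChart_castSucc (lam : ℝ) (y a : Euc n) (i : Fin n) :
    fderiv ℝ (foldChart lam) y a i.castSucc
      = if i = 0 then 2 * y 0 * a 0 / lam ^ 2 else a i := by
  rw [fderiv_coord ((contDiff_foldChart lam).contDiffAt.differentiableAt (by simp))]
  simp only [foldChart_castSucc]
  by_cases h : i = 0
  · simp only [h, if_true, div_eq_mul_inv]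
    rw [HasFDerivAt.fderiv ((HasFDerivAt.pow (hasFDerivAt_apply 0 y) 2).mul_const _)]
    simp
    ring
  · simp only [h, if_false]
    exact fderiv_apply_coord i y a

lemma foldCoord_fderiv_foldChart (lam : ℝ) (y a : Euc n) :
    foldCoord (fderiv ℝ (foldChart lam) y a) = a := by
  ext i
  by_cases h : i = 0 <;> simp [h, fderiv_foldChart_last, fderiv_foldChart_castSucc]

/-- The only coordinate that `foldCoord` forgets is the first one, and the tangency equation `hv`
restores it. -/
lemma fderiv_foldChart_foldCoord {lam : ℝ} (hlam : lam ≠ 0) {q v : Euc (n + 1)}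
    (hv : 2 * q (Fin.last n) * v (Fin.last n) = lam ^ 2 * v 0) :
    fderiv ℝ (foldChart lam) (foldCoord q) (foldCoord v) = v := by
  refine ext_lastCases (by simp [fderiv_foldChart_last]) fun i => ?_
  rw [fderiv_foldChart_castSucc]
  by_cases h : i = 0
  · subst h
    rw [if_pos rfl, foldCoord_apply, if_pos rfl, foldCoord_apply, if_pos rfl, hv,
      Fin.castSucc_zero']
    field_simp
  · simp [h]

/-! ### The fold as an orientable hypersurface and its tangent spaces. -/

lemma proj_zero (q : Euc (n + 1)) : proj q 0 = q 0 := by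
  change q (Fin.castSucc 0) = q 0
  rw [Fin.castSucc_zero']

lemma mem_fold_iff {U : Set (Euc n)} {lam : ℝ} {q : Euc (n + 1)} :
    q ∈ fold U (firstCoord n) lam ↔ proj q ∈ U ∧ q (Fin.last n) ^ 2 = lam ^ 2 * q 0 := by
  simp only [fold, firstCoord, Set.mem_ofPred_eq, proj_zero]

/-- The fold is the graph of x_1 = x_{n+1}²/λ² over the other coordinates, so one chart covers it,
including the points with x_{n+1} = 0 where the two sheets over K meet. -/
lemma isLocalParam_foldChart {U : Set (Euc n)} (hU : IsOpen U) {lam : ℝ} (hlam : lam ≠ 0) :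
    IsLocalParam (fold U (firstCoord n) lam) {y | proj (foldChart lam y) ∈ U} (foldChart lam) where
  isOpen := hU.preimage (continuous_proj.comp (contDiff_foldChart lam).continuous)
  smooth := (contDiff_foldChart lam).contDiffOn
  immersion y _ := Function.LeftInverse.injective (g := foldCoord) (foldCoord_fderiv_foldChart lam y)
  embedding := (Topology.IsEmbedding.of_leftInverse (foldCoord_foldChart lam) continuous_foldCoord
    (contDiff_foldChart lam).continuous).comp Topology.IsEmbedding.subtypeVal
  image := by
    refine ⟨Set.univ, isOpen_univ, ?_⟩
    rw [Set.inter_univ]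
    ext q
    rw [mem_fold_iff]
    constructor
    · rintro ⟨y, hy, rfl⟩
      refine ⟨hy, ?_⟩
      rw [← Fin.castSucc_zero', foldChart_last, foldChart_castSucc, if_pos rfl]
      field_simp
    · rintro ⟨h1, h2⟩
      exact ⟨foldCoord q, by simpa [foldChart_foldCoord hlam h2] using h1,
        foldChart_foldCoord hlam h2⟩

lemma IsLocalParam.isFoldImmersion {U V : Set (Euc n)} {lam : ℝ} {ψ : Euc n → Euc (n + 1)}
    (h : IsLocalParam (fold U (firstCoord n) lam) V ψ) : IsFoldImmersion lam V ψ where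
  isOpen := h.isOpen
  smooth y hy := h.smooth.contDiffAt (h.isOpen.mem_nhds hy)
  immersion := h.immersion
  mem y hy := by
    obtain ⟨W, -, hW⟩ := h.image
    have h1 : ψ y ∈ fold U (firstCoord n) lam ∩ W := hW ▸ Set.mem_image_of_mem ψ hy
    exact (mem_fold_iff.mp h1.1).2

lemma mem_tangentVectors_fold_iff {U : Set (Euc n)} (hU : IsOpen U) {lam : ℝ} (hlam : lam ≠ 0)
    {q : Euc (n + 1)} (hq : q ∈ fold U (firstCoord n) lam) {v : Euc (n + 1)} :
    v ∈ tangentVectors (fold U (firstCoord n) lam) q ↔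
      2 * q (Fin.last n) * v (Fin.last n) = lam ^ 2 * v 0 := by
  obtain ⟨hqU, hq0⟩ := mem_fold_iff.mp hq
  constructor
  · rintro ⟨ε, γ, hε, -, hmem, h0, hγ⟩
    have hc : ∀ i, HasDerivAt (fun t => γ t i) (v i) 0 := fun i =>
      (EuclideanSpace.proj i : Euc (n + 1) →L[ℝ] ℝ).hasFDerivAt.comp_hasDerivAt 0 hγ
    have h1 := (hc (Fin.last n)).fun_pow 2
    have h2 := (hc 0).const_mul (lam ^ 2)
    have h3 : (fun t => γ t (Fin.last n) ^ 2) =ᶠ[nhds 0] fun t => lam ^ 2 * γ t 0 :=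
      Filter.eventuallyEq_of_mem (Ioo_mem_nhds (by linarith) hε)
        fun t ht => (mem_fold_iff.mp (hmem t ht)).2
    have h4 := h3.deriv_eq
    rw [HasDerivAt.deriv h1, HasDerivAt.deriv h2, h0] at h4
    simpa using h4
  · intro hv
    -- A straight line in chart coordinates; its image under `foldChart` is a curve in the fold with
    -- velocity v.
    let c : ℝ → Euc n := fun t => foldCoord q + t • foldCoord v
    have hc : ContDiff ℝ ∞ c := by fun_prop
    have hγ := (contDiff_foldChart lam).comp hc
    have hc0 : c 0 = foldCoord q := by simp [c]
    have hopen := (isLocalParam_foldChart hU hlam).isOpen.preimage hc.continuous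
    have h0 : (0 : ℝ) ∈ c ⁻¹' {y | proj (foldChart lam y) ∈ U} := by
      simpa [hc0, foldChart_foldCoord hlam hq0] using hqU
    obtain ⟨ε, hε, hball⟩ := Metric.isOpen_iff.mp hopen 0 h0
    refine ⟨ε, fun t => foldChart lam (c t), hε, hγ.contDiffOn, fun t ht => ?_, ?_, ?_⟩
    · have ht' : c t ∈ {y | proj (foldChart lam y) ∈ U} := hball (by
        rw [Real.ball_eq_Ioo]; simpa using ht)
      obtain ⟨W, -, hW⟩ := (isLocalParam_foldChart hU hlam).image
      have := hW ▸ Set.mem_image_of_mem (foldChart lam) ht'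
      exact this.1
    · change foldChart lam (c 0) = q
      rw [hc0, foldChart_foldCoord hlam hq0]
    · have hd : HasDerivAt c (foldCoord v) 0 := by
        have := ((hasDerivAt_id (0 : ℝ)).smul_const (foldCoord v)).const_add (foldCoord q)
        rwa [one_smul] at this
      have hf : HasFDerivAt (foldChart lam) (fderiv ℝ (foldChart lam) (c 0)) (c 0) :=
        ((contDiff_foldChart lam).contDiffAt.differentiableAt (by simp)).hasFDerivAt
      have := hf.comp_hasDerivAt 0 hd
      rwa [hc0, fderiv_foldChart_foldCoord hlam hv] at this

/-! ### The frame -/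

lemma frame_last (lam : ℝ) (q : Euc (n + 1)) (i : Fin n) :
    frame lam q i (Fin.last n) = if i = 0 then lam ^ 2 else 0 := by
  have h1 : ¬ (Fin.last n = 0) := by simpa using NeZero.ne n
  by_cases h : i = 0
  · simp [frame, h, h1]
  · simp [frame, h, (Fin.castSucc_lt_last i).ne']

lemma frame_castSucc (lam : ℝ) (q : Euc (n + 1)) (i j : Fin n) :
    frame lam q i j.castSucc =
      if i = 0 then (if j = 0 then 2 * q (Fin.last n) else 0) else if j = i then 1 else 0 := by
  by_cases h : i = 0
  · simp [frame, h, (Fin.castSucc_lt_last j).ne]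
  · simp [frame, h, Fin.castSucc_inj]

lemma frame_zero (lam : ℝ) (q : Euc (n + 1)) (i : Fin n) :
    frame lam q i 0 = if i = 0 then 2 * q (Fin.last n) else 0 := by
  rw [← Fin.castSucc_zero', frame_castSucc]
  by_cases h : i = 0
  · simp [h]
  · simp [h, Ne.symm h]

lemma frame_tangent (lam : ℝ) (q : Euc (n + 1)) (i : Fin n) :
    2 * q (Fin.last n) * frame lam q i (Fin.last n) = lam ^ 2 * frame lam q i 0 := by
  rw [frame_last, frame_zero]
  split_ifs <;> ring

lemma sum_smul_frame_last (lam : ℝ) (q : Euc (n + 1)) (c : Fin n → ℝ) :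
    (∑ i, c i • frame lam q i) (Fin.last n) = c 0 * lam ^ 2 := by
  simp [Finset.sum_apply, frame_last]

lemma sum_smul_frame_castSucc (lam : ℝ) (q : Euc (n + 1)) (c : Fin n → ℝ) (j : Fin n) :
    (∑ i, c i • frame lam q i) j.castSucc = if j = 0 then c 0 * (2 * q (Fin.last n)) else c j := by
  simp only [WithLp.ofLp_sum, Finset.sum_apply, PiLp.smul_apply, frame_castSucc, smul_eq_mul]
  by_cases h : j = 0
  · subst h
    rw [Finset.sum_eq_single 0]
    · simp
    · intro i _ hi; simp [hi, Ne.symm hi]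
    · simp
  · rw [Finset.sum_eq_single j]
    · simp [h]
    · intro i _ hi
      simp [h, Ne.symm hi]
    · simp

lemma linearIndependent_frame {lam : ℝ} (hlam : lam ≠ 0) (q : Euc (n + 1)) :
    LinearIndependent ℝ (frame lam q) := by
  rw [Fintype.linearIndependent_iff]
  intro c hc i
  have h0 : c 0 = 0 := by
    have := sum_smul_frame_last lam q c
    rw [hc] at this
    have h1 : c 0 * lam ^ 2 = 0 := this.symm
    exact (mul_eq_zero.mp h1).resolve_right (pow_ne_zero _ hlam)
  by_cases h : i = 0
  · rw [h, h0]
  · have := sum_smul_frame_castSucc lam q c i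
    rw [hc, if_neg h] at this
    exact this.symm

lemma mem_span_frame_iff {lam : ℝ} (hlam : lam ≠ 0) {q v : Euc (n + 1)} :
    v ∈ Submodule.span ℝ (Set.range (frame lam q)) ↔
      2 * q (Fin.last n) * v (Fin.last n) = lam ^ 2 * v 0 := by
  constructor
  · intro hv
    induction hv using Submodule.span_induction with
    | mem x hx => obtain ⟨i, rfl⟩ := hx; exact frame_tangent lam q i
    | zero => simp
    | add x y _ _ hx hy => simp only [PiLp.add_apply]; linear_combination hx + hy
    | smul a x _ hx => simp only [PiLp.smul_apply, smul_eq_mul]; linear_combination a * hx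
  · intro hv
    -- The coefficient of v_1 is read off from the last coordinate, the others directly; agreement
    -- in the first coordinate is the tangency equation.
    have : v = ∑ i, (if i = 0 then v (Fin.last n) / lam ^ 2 else v i.castSucc) •
        frame lam q i := by
      refine ext_lastCases ?_ fun j => ?_
      · rw [sum_smul_frame_last, if_pos rfl]; field_simp
      · rw [sum_smul_frame_castSucc]
        by_cases h : j = 0
        · subst h
          rw [if_pos rfl, if_pos rfl, Fin.castSucc_zero']
          field_simp
          linarith
        · simp [h]
    rw [this]
    exact Submodule.sum_mem _ fun i _ => Submodule.smul_mem _ _ (Submodule.subset_span ⟨i, rfl⟩)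

lemma tangentVectors_fold {U : Set (Euc n)} (hU : IsOpen U) {lam : ℝ} (hlam : lam ≠ 0)
    {q : Euc (n + 1)} (hq : q ∈ fold U (firstCoord n) lam) :
    tangentVectors (fold U (firstCoord n) lam) q
      = (Submodule.span ℝ (Set.range (frame lam q)) : Set (Euc (n + 1))) := by
  ext v
  rw [mem_tangentVectors_fold_iff hU hlam hq, SetLike.mem_coe, mem_span_frame_iff hlam]

lemma isOrientableHypersurface_fold {U : Set (Euc n)} (hU : IsOpen U) {lam : ℝ} (hlam : lam ≠ 0) :
    IsOrientableHypersurface (fold U (firstCoord n) lam) where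
  charts q hq := by
    refine ⟨_, _, isLocalParam_foldChart hU hlam, foldCoord q, ?_,
      foldChart_foldCoord hlam (mem_fold_iff.mp hq).2⟩
    simpa [foldChart_foldCoord hlam (mem_fold_iff.mp hq).2] using (mem_fold_iff.mp hq).1
  orientable := by
    have h1 : ¬ (0 = Fin.last n) := fun h => NeZero.ne n (by simpa using h.symm)
    -- The normal field is the Euclidean gradient of F_λ, nonzero everywhere because its e_1
    -- component is -λ².
    refine ⟨fun q => (2 * q (Fin.last n)) • e (Fin.last n) - lam ^ 2 • e 0,
      Continuous.continuousOn (by fun_prop), fun q hq => ⟨fun h0 => ?_, fun v hv => ?_⟩⟩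
    · have := congrArg (fun v : Euc (n + 1) => v 0) h0
      simp [h1, hlam] at this
    · rw [mem_tangentVectors_fold_iff hU hlam hq] at hv
      rw [inner_sub_left, real_inner_smul_left, real_inner_smul_left, inner_e_left, inner_e_left,
        hv, sub_self]

/-! ### Sectional curvatures -/

lemma gram_det_pos {E : Type*} [NormedAddCommGroup E] [InnerProductSpace ℝ E] {u w : E}
    (h : LinearIndependent ℝ ![u, w]) :
    0 < (inner ℝ u u : ℝ) * inner ℝ w w - inner ℝ u w ^ 2 := by
  have h1 := (Matrix.posDef_gram_of_linearIndependent h).det_pos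
  rw [Matrix.det_fin_two] at h1
  simp only [Matrix.gram_apply, Matrix.cons_val_zero, Matrix.cons_val_one] at h1
  rw [real_inner_comm u w] at h1
  linarith

/-- Any chart yields `foldSec`, which mentions only q, u and w, so the value is chart-independent;
`foldChart` shows that it is attained. -/
lemma hasSec_fold {U : Set (Euc n)} (hU : IsOpen U) {lam : ℝ} (hlam : lam ≠ 0)
    {q : Euc (n + 1)} (hq : q ∈ fold U (firstCoord n) lam) {u w : Euc (n + 1)}
    (hu : 2 * q (Fin.last n) * u (Fin.last n) = lam ^ 2 * u 0)
    (hw : 2 * q (Fin.last n) * w (Fin.last n) = lam ^ 2 * w 0)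
    (hli : LinearIndependent ℝ ![u, w]) :
    HasSec sphericalMetric (fold U (firstCoord n) lam) q u w (foldSec lam q u w) := by
  have hD := (gram_det_pos hli).ne'
  have hq0 := foldChart_foldCoord hlam (mem_fold_iff.mp hq).2
  have key : ∀ {V ψ y a b}, IsLocalParam (fold U (firstCoord n) lam) V ψ → y ∈ V → ψ y = q →
      fderiv ℝ ψ y a = u → fderiv ℝ ψ y b = w →
      coordSec (pullback sphericalMetric ψ) y a b = foldSec lam q u w := by
    rintro V ψ y a b h hy rfl rfl rfl
    exact h.isFoldImmersion.coordSec_eq hlam hy a b hD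
  intro t
  constructor
  · rintro ⟨V, ψ, y, a, b, h, hy, h1, h2, h3, rfl⟩
    exact key h hy h1 h2 h3
  · rintro rfl
    have hy : foldCoord q ∈ {y | proj (foldChart lam y) ∈ U} := by
      simpa [hq0] using (mem_fold_iff.mp hq).1
    have h2 := fderiv_foldChart_foldCoord hlam hu
    have h3 := fderiv_foldChart_foldCoord hlam hw
    have h := isLocalParam_foldChart hU hlam
    exact ⟨_, _, _, _, _, h, hy, hq0, h2, h3, (key h hy hq0 h2 h3).symm⟩

end Folds

namespace Folds

/-! ### Gradient and Hessian -/

lemma sphericalMetric_apply {m : ℕ} (x : Euc m) (i j : Fin m) :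
    sphericalMetric x i j = (2 / (1 + ‖x‖ ^ 2)) ^ 2 * if i = j then 1 else 0 := by
  simp only [sphericalMetric, Matrix.smul_apply, Matrix.one_apply, smul_eq_mul]
  congr 1
  rw [div_pow]
  norm_num

lemma sphericalMetric_inv_apply {m : ℕ} (x : Euc m) (i j : Fin m) :
    (sphericalMetric x)⁻¹ i j = ((2 / (1 + ‖x‖ ^ 2)) ^ 2)⁻¹ * if i = j then 1 else 0 := by
  have h0 := (one_add_norm_sq_pos x).ne'
  have : (sphericalMetric x)⁻¹
      = (((2 / (1 + ‖x‖ ^ 2)) ^ 2)⁻¹ • 1 : Matrix (Fin m) (Fin m) ℝ) := by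
    refine Matrix.inv_eq_right_inv ?_
    have h1 : 4 / (1 + ‖x‖ ^ 2) ^ 2 * ((2 / (1 + ‖x‖ ^ 2)) ^ 2)⁻¹ = 1 := by field_simp; norm_num
    rw [sphericalMetric, Matrix.smul_mul, Matrix.mul_smul, smul_smul, Matrix.one_mul, h1, one_smul]
  rw [this, Matrix.smul_apply, Matrix.one_apply, smul_eq_mul]

lemma pd_sphericalMetric {m : ℕ} (k i j : Fin m) (x : Euc m) :
    pd k (fun z => sphericalMetric z i j) x
      = -2 * (2 / (1 + ‖x‖ ^ 2)) ^ 3 * x k * if i = j then 1 else 0 := by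
  have h1 : (fun z : Euc m => sphericalMetric z i j) =
      fun z => (2 / (1 + ‖z‖ ^ 2)) ^ 2 * if i = j then 1 else 0 :=
    funext fun z => sphericalMetric_apply z i j
  have h2 := (HasFDerivAt.pow (hasFDerivAt_two_div_one_add_norm_sq x) 2).mul_const
    (if i = j then (1 : ℝ) else 0)
  rw [pd, h1, h2.fderiv]
  simp only [smul_apply, innerSL_apply_apply, smul_eq_mul, inner_e_right, neg_mul, nsmul_eq_mul]
  push_cast
  ring

/-- The usual formula for a conformally flat metric e^{2φ}δ, here with φ = log Z, Z = 2/(1+r²) and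
∂_kφ = -Z·x_k. -/
lemma christoffel_sphericalMetric {m : ℕ} (i j k : Fin m) (x : Euc m) :
    christoffel sphericalMetric i j k x = -(2 / (1 + ‖x‖ ^ 2)) *
      (x i * (if j = k then 1 else 0) + x j * (if i = k then 1 else 0)
        - x k * if i = j then 1 else 0) := by
  have h0 := (one_add_norm_sq_pos x).ne'
  simp only [christoffel, sphericalMetric_inv_apply, pd_sphericalMetric]
  rw [Finset.sum_eq_single k]
  · rw [if_pos rfl]
    field_simp
    ring
  · intro l _ hl
    rw [if_neg (Ne.symm hl)]
    ring
  · simp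

lemma grad_sphericalMetric {m : ℕ} (F : Euc m → ℝ) (x : Euc m) :
    grad sphericalMetric F x = ((1 + ‖x‖ ^ 2) ^ 2 / 4) • ∑ i, pd i F x • e i := by
  simp only [grad, sphericalMetric_inv_apply, mul_ite, mul_one, mul_zero, ite_mul, zero_mul,
    Finset.sum_ite_eq, Finset.mem_univ, if_true, Finset.smul_sum, smul_smul]
  refine Finset.sum_congr rfl fun i _ => ?_
  congr 2
  field_simp
  norm_num

lemma hess_sphericalMetric {m : ℕ} (F : Euc m → ℝ) (x : Euc m) (i j : Fin m) :
    hess sphericalMetric F x i j = pd i (pd j F) x + (2 / (1 + ‖x‖ ^ 2)) *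
      (x i * pd j F x + x j * pd i F x - (∑ k, x k * pd k F x) * if i = j then 1 else 0) := by
  have : ∑ k, christoffel sphericalMetric i j k x * pd k F x = -(2 / (1 + ‖x‖ ^ 2)) *
      (x i * pd j F x + x j * pd i F x - (∑ k, x k * pd k F x) * if i = j then 1 else 0) := by
    simp only [christoffel_sphericalMetric, mul_assoc, ← Finset.mul_sum, add_mul, sub_mul,
      Finset.sum_add_distrib, Finset.sum_sub_distrib, Finset.sum_mul]
    congr 2
    · simp
    · refine Finset.sum_congr rfl fun k _ => by ring
  rw [hess, Matrix.of_apply, this]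
  ring

lemma bil_hess_sphericalMetric {m : ℕ} (F : Euc m → ℝ) (x u w : Euc m) :
    bil (hess sphericalMetric F x) u w = ∑ i, ∑ j, u i * pd i (pd j F) x * w j +
      (2 / (1 + ‖x‖ ^ 2)) * (inner ℝ x u * ∑ j, pd j F x * w j + inner ℝ x w * ∑ i, pd i F x * u i
        - inner ℝ u w * ∑ k, x k * pd k F x) := by
  have h1 : ∀ a b : Euc m, (inner ℝ a b : ℝ) = ∑ i, a i * b i := fun a b => by
    rw [PiLp.inner_apply]
    refine Finset.sum_congr rfl fun i _ => ?_
    simp only [RCLike.inner_apply, conj_trivial, mul_comm]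
  have h2 : (inner ℝ u w : ℝ) * ∑ k, x k * pd k F x =
      ∑ i, ∑ j, u i * ((∑ k, x k * pd k F x) * if i = j then 1 else 0) * w j := by
    rw [h1, Finset.sum_mul]
    refine Finset.sum_congr rfl fun i _ => ?_
    simp only [mul_ite, mul_one, mul_zero, ite_mul, zero_mul, Finset.sum_ite_eq, Finset.mem_univ,
      if_true]
    ring
  rw [h2, h1 x u, h1 x w, Finset.sum_mul_sum, Finset.sum_mul_sum,
    Finset.sum_comm (f := fun i j => x i * w i * (pd j F x * u j))]
  simp only [bil, hess_sphericalMetric, Finset.mul_sum, ← Finset.sum_add_distrib,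
    ← Finset.sum_sub_distrib]
  refine Finset.sum_congr rfl fun i _ => Finset.sum_congr rfl fun j _ => by ring

section Fold

variable {n : ℕ} [NeZero n]

lemma fin_last_ne_zero : Fin.last n ≠ 0 := by simpa using NeZero.ne n

lemma foldFun_firstCoord (lam : ℝ) :
    foldFun (firstCoord n) lam = fun q => q (Fin.last n) ^ 2 - lam ^ 2 * q 0 := by
  funext q
  rw [foldFun, firstCoord, proj_zero]

lemma pd_foldFun (lam : ℝ) (j : Fin (n + 1)) (q : Euc (n + 1)) :
    pd j (foldFun (firstCoord n) lam) q = 2 * q (Fin.last n) * (if j = Fin.last n then 1 else 0)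
      - lam ^ 2 * if j = 0 then 1 else 0 := by
  have h := (HasFDerivAt.pow (hasFDerivAt_apply (Fin.last n) q) 2).sub
    ((hasFDerivAt_apply 0 q).const_mul (lam ^ 2))
  rw [pd, foldFun_firstCoord]
  refine (congrArg (fun L : Euc (n + 1) →L[ℝ] ℝ => L (e j)) (HasFDerivAt.fderiv h)).trans ?_
  simp [eq_comm]

lemma pd_pd_foldFun (lam : ℝ) (i j : Fin (n + 1)) (q : Euc (n + 1)) :
    pd i (pd j (foldFun (firstCoord n) lam)) q =
      2 * (if i = Fin.last n then 1 else 0) * if j = Fin.last n then 1 else 0 := by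
  have h := (((hasFDerivAt_apply (Fin.last n) q).const_mul 2).mul_const
    (if j = Fin.last n then (1 : ℝ) else 0)).sub_const (lam ^ 2 * if j = 0 then 1 else 0)
  have h1 : pd j (foldFun (firstCoord n) lam) = fun q =>
      2 * q (Fin.last n) * (if j = Fin.last n then 1 else 0) - lam ^ 2 * if j = 0 then 1 else 0 :=
    funext fun q => pd_foldFun lam j q
  rw [h1, pd]
  refine (congrArg (fun L : Euc (n + 1) →L[ℝ] ℝ => L (e i)) (HasFDerivAt.fderiv h)).trans ?_
  by_cases hj : j = Fin.last n <;> simp [hj, eq_comm]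

lemma grad_foldFun (lam : ℝ) (q : Euc (n + 1)) :
    grad sphericalMetric (foldFun (firstCoord n) lam) q = ((1 + ‖q‖ ^ 2) ^ 2 / 4) •
      (-(lam ^ 2) • e 0 + (2 * q (Fin.last n)) • e (Fin.last n)) := by
  rw [grad_sphericalMetric]
  congr 1
  simp only [pd_foldFun, sub_smul, Finset.sum_sub_distrib, mul_ite, mul_one, mul_zero, ite_smul,
    zero_smul, Finset.sum_ite_eq', Finset.mem_univ, if_true]
  module

lemma sum_mul_pd_foldFun (lam : ℝ) (q u : Euc (n + 1)) :
    ∑ i, u i * pd i (foldFun (firstCoord n) lam) q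
      = 2 * q (Fin.last n) * u (Fin.last n) - lam ^ 2 * u 0 := by
  simp only [pd_foldFun, mul_sub, Finset.sum_sub_distrib, mul_ite, mul_one, mul_zero,
    Finset.sum_ite_eq', Finset.mem_univ, if_true]
  ring

/-- On tangent vectors dF_λ vanishes, so of the Christoffel terms only the one with the radial
derivative of F_λ survives, and that equals 2x_{n+1}² - λ²x_1 = λ²x_1 on the fold. This identifies
the form found extrinsically with the Riemannian Hessian. -/
lemma bil_hess_foldFun {lam : ℝ} {q u w : Euc (n + 1)}
    (hq : q (Fin.last n) ^ 2 = lam ^ 2 * q 0)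
    (hu : 2 * q (Fin.last n) * u (Fin.last n) = lam ^ 2 * u 0)
    (hw : 2 * q (Fin.last n) * w (Fin.last n) = lam ^ 2 * w 0) :
    bil (hess sphericalMetric (foldFun (firstCoord n) lam) q) u w = foldHess lam q u w := by
  have h1 : ∑ i, ∑ j, u i * pd i (pd j (foldFun (firstCoord n) lam)) q * w j
      = 2 * u (Fin.last n) * w (Fin.last n) := by
    simp only [pd_pd_foldFun, mul_ite, mul_one, mul_zero, ite_mul, zero_mul, Finset.sum_ite_eq',
      Finset.mem_univ, if_true]
    ring
  rw [bil_hess_sphericalMetric, h1]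
  simp only [mul_comm (pd _ (foldFun (firstCoord n) lam) q), sum_mul_pd_foldFun, foldHess]
  rw [hu, hw]
  linear_combination (-(2 / (1 + ‖q‖ ^ 2)) * inner ℝ u w * 2) * hq

/-! ### Sectional curvatures in terms of the frame -/

lemma inner_frame_left (lam : ℝ) (q w : Euc (n + 1)) (i : Fin n) :
    (inner ℝ (frame lam q i) w : ℝ)
      = if i = 0 then 2 * q (Fin.last n) * w 0 + lam ^ 2 * w (Fin.last n) else w i.castSucc := by
  unfold frame
  split_ifs <;> simp [inner_add_left, real_inner_smul_left]

lemma inner_frame {lam : ℝ} {q : Euc (n + 1)} (hq : q (Fin.last n) ^ 2 = lam ^ 2 * q 0)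
    (i j : Fin n) : (inner ℝ (frame lam q i) (frame lam q j) : ℝ)
      = if i = j then (if i = 0 then lam ^ 4 + 4 * lam ^ 2 * q 0 else 1) else 0 := by
  rw [inner_frame_left]
  by_cases hi : i = 0
  · subst hi
    by_cases hj : j = 0
    · subst hj
      simp only [if_true, frame_zero, frame_last]
      linear_combination 4 * hq
    · simp [hj, Ne.symm hj, frame_zero, frame_last]
  · by_cases hj : j = 0
    · subst hj
      simp [hi, frame_castSucc]
    · simp [hi, hj, frame_castSucc]

lemma foldHess_frame {lam : ℝ} {q : Euc (n + 1)} (hq : q (Fin.last n) ^ 2 = lam ^ 2 * q 0)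
    (i j : Fin n) : foldHess lam q (frame lam q i) (frame lam q j) =
      if i = j then
        if i = 0 then
          2 * lam ^ 4 - 8 * lam ^ 4 * q 0 ^ 2 / (1 + ‖q‖ ^ 2)
            - 2 * lam ^ 6 * q 0 / (1 + ‖q‖ ^ 2)
        else -(2 * lam ^ 2 * q 0 / (1 + ‖q‖ ^ 2))
      else 0 := by
  have h0 := (one_add_norm_sq_pos q).ne'
  rw [foldHess, inner_frame hq, frame_last, frame_last]
  by_cases hij : i = j
  · subst hij
    by_cases hi : i = 0
    · simp only [hi, if_true]
      field_simp
      ring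
    · simp only [hi, if_true, if_false]
      ring
  · by_cases hi : i = 0
    · subst hi
      simp [Ne.symm hij, hij]
    · simp [hi, hij]

lemma linearIndependent_frame_pair {lam : ℝ} (hlam : lam ≠ 0) (q : Euc (n + 1)) {i j : Fin n}
    (hij : i ≠ j) : LinearIndependent ℝ ![frame lam q i, frame lam q j] := by
  have hinj : Function.Injective ![i, j] := by
    intro a b hab
    fin_cases a <;> fin_cases b <;> simp_all [eq_comm]
  have := (linearIndependent_frame hlam q).comp ![i, j] hinj
  convert this using 1
  funext a
  fin_cases a <;> rfl

lemma foldSec_frame {lam : ℝ} (hlam : lam ≠ 0) {q : Euc (n + 1)}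
    (hq : q (Fin.last n) ^ 2 = lam ^ 2 * q 0) (hq0 : 0 ≤ q 0) {i j : Fin n} (hi : i ≠ 0)
    (hj : j ≠ 0) (hij : i ≠ j) : foldSec lam q (frame lam q i) (frame lam q j) =
      1 + 4 * lam ^ 4 * q 0 ^ 2 /
        ((1 + ‖q‖ ^ 2) ^ 2 *
          ip sphericalMetric q (grad sphericalMetric (foldFun (firstCoord n) lam) q)
            (grad sphericalMetric (foldFun (firstCoord n) lam) q) *
          ip sphericalMetric q (frame lam q i) (frame lam q i) *
          ip sphericalMetric q (frame lam q j) (frame lam q j)) := by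
  have h0 := (one_add_norm_sq_pos q).ne'
  have hμ : lam ^ 4 + 4 * lam ^ 2 * q 0 ≠ 0 := by positivity
  have hgrad : (inner ℝ (-(lam ^ 2) • e 0 + (2 * q (Fin.last n)) • e (Fin.last n) : Euc (n + 1))
      (-(lam ^ 2) • e 0 + (2 * q (Fin.last n)) • e (Fin.last n)) : ℝ)
      = lam ^ 4 + 4 * lam ^ 2 * q 0 := by
    simp only [inner_add_left, inner_add_right, real_inner_smul_left, real_inner_smul_right,
      inner_e_left, e_apply, fin_last_ne_zero, fin_last_ne_zero.symm, if_true, if_false]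
    linear_combination 4 * hq
  simp only [ip_sphericalMetric, grad_foldFun, real_inner_smul_left, real_inner_smul_right, hgrad,
    foldSec, foldHess_frame hq, inner_frame hq, hi, hj, hij, if_true, if_false]
  field_simp
  ring

/-- On the fold ‖q‖² = ‖x‖² + λ²x_1, which trades the quadratic form in ξ for the factor 1 + ‖q‖²
occurring in `foldSec`. -/
lemma quad_proj {lam : ℝ} {q : Euc (n + 1)} (hq : q (Fin.last n) ^ 2 = lam ^ 2 * q 0) :
    quad (proj q) = 4 * q 0 ^ 2 + lam ^ 2 * q 0 - (1 + ‖q‖ ^ 2) := by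
  rw [EuclideanSpace.real_norm_sq_eq, Fin.sum_univ_castSucc, hq,
    ← Finset.add_sum_erase _ _ (Finset.mem_univ (0 : Fin n)), Fin.castSucc_zero', quad, proj_zero]
  simp only [proj]
  ring

lemma foldSec_frame_zero {lam : ℝ} (hlam : lam ≠ 0) {q : Euc (n + 1)}
    (hq : q (Fin.last n) ^ 2 = lam ^ 2 * q 0) (hq0 : 0 ≤ q 0) {j : Fin n} (hj : j ≠ 0) :
    foldSec lam q (frame lam q 0) (frame lam q j) = 1 + xi lam (proj q) := by
  have h0 := (one_add_norm_sq_pos q).ne'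
  have hμ : lam ^ 4 + 4 * lam ^ 2 * q 0 ≠ 0 := by positivity
  have hκ : 4 * q 0 + lam ^ 2 ≠ 0 := by positivity
  have h1 : lam ^ 4 + 4 * lam ^ 2 * q 0 = lam ^ 2 * (4 * q 0 + lam ^ 2) := by ring
  simp only [foldSec, foldHess_frame hq, inner_frame hq, hj, hj.symm, if_true, if_false, xi,
    quad_proj hq, proj_zero, h1]
  field_simp
  ring

/-- Let D be the Gram determinant of u, w, let κ = 4x_1 + λ² and s = 1 + ‖q‖². The difference of the
two sides is x_1·s·(λ²D - κQ)/(κ²D), where Q collects the last coordinates of u and w. The Gram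
determinant of v_1, u, w equals κ(λ²D - κQ), so the difference is nonnegative. -/
lemma xi_le_foldSec {lam : ℝ} (hlam : lam ≠ 0) {q u w : Euc (n + 1)}
    (hq : q (Fin.last n) ^ 2 = lam ^ 2 * q 0) (hq0 : 0 ≤ q 0)
    (hu : 2 * q (Fin.last n) * u (Fin.last n) = lam ^ 2 * u 0)
    (hw : 2 * q (Fin.last n) * w (Fin.last n) = lam ^ 2 * w 0)
    (hli : LinearIndependent ℝ ![u, w]) : 1 + xi lam (proj q) ≤ foldSec lam q u w := by
  have hs := one_add_norm_sq_pos q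
  have hκ : 0 < 4 * q 0 + lam ^ 2 := by positivity
  have hD := gram_det_pos hli
  have hlam2 : lam ^ 2 ≠ 0 := pow_ne_zero _ hlam
  -- For tangent v the last coordinate is, up to the factor κ, the inner product with v_1; this is
  -- how the Gram determinant of three vectors enters.
  have hf : ∀ v : Euc (n + 1), 2 * q (Fin.last n) * v (Fin.last n) = lam ^ 2 * v 0 →
      (inner ℝ (frame lam q 0) v : ℝ) = (4 * q 0 + lam ^ 2) * v (Fin.last n) := fun v hv => by
    rw [inner_frame_left, if_pos rfl]
    refine mul_left_cancel₀ hlam2 ?_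
    linear_combination (-2 * q (Fin.last n)) * hv + 4 * v (Fin.last n) * hq
  have hff : (inner ℝ (frame lam q 0) (frame lam q 0) : ℝ) = lam ^ 2 * (4 * q 0 + lam ^ 2) := by
    rw [inner_frame hq, if_pos rfl, if_pos rfl]; ring
  have hgram := (Matrix.posSemidef_gram (𝕜 := ℝ) ![frame lam q 0, u, w]).det_nonneg
  rw [Matrix.det_fin_three] at hgram
  simp only [Matrix.gram_apply, Matrix.cons_val_zero, Matrix.cons_val_one, Matrix.cons_val] at hgram
  rw [real_inner_comm (frame lam q 0) u, real_inner_comm (frame lam q 0) w, real_inner_comm u w,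
    hff, hf u hu, hf w hw] at hgram
  simp only [foldSec, foldHess, xi, quad_proj hq, proj_zero]
  set s := 1 + ‖q‖ ^ 2
  set κ := 4 * q 0 + lam ^ 2 with hκdef
  generalize (inner ℝ u u : ℝ) = g11 at *
  generalize (inner ℝ w w : ℝ) = g22 at *
  generalize (inner ℝ u w : ℝ) = g12 at *
  generalize u (Fin.last n) = α at *
  generalize w (Fin.last n) = β at *
  set Q := α ^ 2 * g22 + β ^ 2 * g11 - 2 * α * β * g12 with hQ
  have hQD : 0 ≤ lam ^ 2 * (g11 * g22 - g12 ^ 2) - κ * Q := by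
    have : 0 ≤ κ * (lam ^ 2 * (g11 * g22 - g12 ^ 2) - κ * Q) := by
      rw [hQ]; linarith
    exact nonneg_of_mul_nonneg_right this hκ
  have hμ : lam ^ 4 + 4 * lam ^ 2 * q 0 = lam ^ 2 * κ := by rw [hκdef]; ring
  have key : s ^ 2 * ((2 * α * α - 2 * lam ^ 2 * q 0 / s * g11) *
      (2 * β * β - 2 * lam ^ 2 * q 0 / s * g22) - (2 * α * β - 2 * lam ^ 2 * q 0 / s * g12) ^ 2) /
      (4 * (lam ^ 4 + 4 * lam ^ 2 * q 0) * (g11 * g22 - g12 ^ 2)) -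
      lam ^ 2 * q 0 * (4 * q 0 ^ 2 + lam ^ 2 * q 0 - s) / κ ^ 2 =
      q 0 * s * (lam ^ 2 * (g11 * g22 - g12 ^ 2) - κ * Q) / (κ ^ 2 * (g11 * g22 - g12 ^ 2)) := by
    have hq2 : 4 * q 0 ^ 2 + lam ^ 2 * q 0 - s = q 0 * κ - s := by rw [hκdef]; ring
    have hnum : s ^ 2 * ((2 * α * α - 2 * lam ^ 2 * q 0 / s * g11) *
      (2 * β * β - 2 * lam ^ 2 * q 0 / s * g22) - (2 * α * β - 2 * lam ^ 2 * q 0 / s * g12) ^ 2)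
      = 4 * lam ^ 2 * q 0 * (lam ^ 2 * q 0 * (g11 * g22 - g12 ^ 2) - s * Q) := by
      rw [hQ]; field_simp; ring
    rw [hnum, hμ, hq2]
    generalize g11 * g22 - g12 ^ 2 = D at *
    field_simp
    ring
  have : 0 ≤ q 0 * s * (lam ^ 2 * (g11 * g22 - g12 ^ 2) - κ * Q) /
      (κ ^ 2 * (g11 * g22 - g12 ^ 2)) := by positivity
  linarith

/-! ### The half-space and the neighbourhood of the origin -/

lemma isOpen_nbhd : IsOpen (nbhd n) := by
  have hq : Continuous (quad : Euc n → ℝ) := by unfold quad; fun_prop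
  exact ((isOpen_lt continuous_const hq).inter (isOpen_lt hq continuous_const)).inter
    Metric.isOpen_ball

lemma zero_mem_nbhd : (0 : Euc n) ∈ nbhd n := by
  have : quad (0 : Euc n) = -1 := by simp [quad]
  refine ⟨?_, by simp⟩
  change -(3 / 2) < quad (0 : Euc n) ∧ quad (0 : Euc n) < 0
  rw [this]; norm_num

lemma frontier_halfSpace_eq : frontier (halfSpace n) = {x : Euc n | x 0 = 0} := by
  have := frontier_halfSpace (n := n) 2 0 0
  rw [halfSpace]
  refine this.trans ?_
  ext x
  exact eq_comm

lemma isDefiningFunction_firstCoord {U : Set (Euc n)} (hU : IsOpen U)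
    (hb : Bornology.IsBounded U) : IsDefiningFunction (halfSpace n) U (firstCoord n) where
  isOpen := hU
  bounded := hb
  smooth := ⟨Set.univ, isOpen_univ, Set.subset_univ _, by unfold firstCoord; fun_prop⟩
  regular x _ _ h := by
    have h1 : fderiv ℝ (firstCoord n) x (e 0) = 1 := by
      refine (fderiv_apply_coord 0 x (e 0)).trans ?_
      simp
    rw [h] at h1
    simp at h1
  table := by
    ext x
    exact and_comm
  boundary := by
    rw [frontier_halfSpace_eq]
    ext x
    exact and_comm

lemma isBilliardTable_halfSpace : IsBilliardTable (halfSpace n) := by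
  refine ⟨⟨{x | 0 < x 0}, ?_, ?_, ?_⟩, fun p _ => ⟨Metric.ball p 1, firstCoord n,
    Metric.mem_ball_self one_pos,
    isDefiningFunction_firstCoord Metric.isOpen_ball Metric.isBounded_ball⟩⟩
  · exact isOpen_lt continuous_const (by fun_prop)
  · refine ⟨⟨e 0, by simp⟩, Convex.isPreconnected ?_⟩
    exact convex_halfSpace_gt (EuclideanSpace.proj (0 : Fin n) : Euc n →L[ℝ] ℝ).isLinear 0
  · exact (closure_open_halfSpace (n := n) 2 0 0).symm

/-- The neighbourhood gives the quadratic factor the lower bound -3/2, and the arithmetic-geometric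
mean inequality gives (4x_1 + λ²)² ≥ 16λ²x_1; the constant is (3/2)/16. -/
lemma neg_le_xi {lam : ℝ} (hlam : lam ≠ 0) {x : Euc n} (hx : x ∈ halfSpace n ∩ nbhd n) :
    -(3 / 32) ≤ xi lam x := by
  obtain ⟨hx0 : 0 ≤ x 0, ⟨hq, -⟩, -⟩ := hx
  rw [xi, le_div_iff₀ (by positivity)]
  have h1 : 0 ≤ lam ^ 2 * x 0 := by positivity
  nlinarith [sq_nonneg (4 * x 0 - lam ^ 2), mul_le_mul_of_nonneg_left hq.le h1]

/-! ### Curvature bounds for the folds. -/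

lemma nonneg_of_mem_fold {U : Set (Euc n)} {lam : ℝ} (hlam : lam ≠ 0) {q : Euc (n + 1)}
    (hq : q ∈ fold U (firstCoord n) lam) : 0 ≤ q 0 :=
  nonneg_of_mul_nonneg_right ((mem_fold_iff.mp hq).2 ▸ sq_nonneg _)
    (by positivity : 0 < lam ^ 2)

lemma exists_hasSec_fold {U : Set (Euc n)} (hU : IsOpen U) {lam : ℝ} (hlam : lam ≠ 0)
    {q : Euc (n + 1)} (hq : q ∈ fold U (firstCoord n) lam) {u w : Euc (n + 1)}
    (hu : u ∈ tangentVectors (fold U (firstCoord n) lam) q)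
    (hw : w ∈ tangentVectors (fold U (firstCoord n) lam) q) (hli : LinearIndependent ℝ ![u, w]) :
    ∃ s : ℝ, HasSec sphericalMetric (fold U (firstCoord n) lam) q u w s ∧
      1 + xi lam (proj q) ≤ s := by
  rw [mem_tangentVectors_fold_iff hU hlam hq] at hu hw
  exact ⟨_, hasSec_fold hU hlam hq hu hw hli,
    xi_le_foldSec hlam (mem_fold_iff.mp hq).2 (nonneg_of_mem_fold hlam hq) hu hw hli⟩

lemma curvatureBoundedBelow_fold {lam : ℝ} (hlam : lam ≠ 0) :
    CurvatureBoundedBelow sphericalMetric (fold (nbhd n) (firstCoord n) lam) 0 := by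
  refine ⟨isOrientableHypersurface_fold isOpen_nbhd hlam, fun q hq u hu w hw hli => ?_⟩
  obtain ⟨s, hs, hle⟩ := exists_hasSec_fold isOpen_nbhd hlam hq hu hw hli
  have h0 : proj q ∈ halfSpace n := by
    change 0 ≤ proj q 0
    rw [proj_zero]
    exact nonneg_of_mem_fold hlam hq
  have := neg_le_xi hlam ⟨h0, (mem_fold_iff.mp hq).1⟩
  exact ⟨s, hs, by linarith⟩

end Fold
end Folds

/-! ### The main theorem. -/

theorem mainTheorem7 (n : ℕ) [NeZero n] :
    -- the setting: the half-space is a billiard table, described near the origin by `x_1` on `U`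
    IsBilliardTable (halfSpace n) ∧ (0 : Euc n) ∈ frontier (halfSpace n) ∧
    (0 : Euc n) ∈ nbhd n ∧ IsDefiningFunction (halfSpace n) (nbhd n) (firstCoord n) ∧
    (∀ lam ∈ Set.Ioo (0 : ℝ) 1,
      (∀ q ∈ fold (nbhd n) (firstCoord n) lam,
        -- basis of the tangent space
        (tangentVectors (fold (nbhd n) (firstCoord n) lam) q =
            (Submodule.span ℝ (Set.range (frame lam q)) : Set (Euc (n + 1))) ∧
          LinearIndependent ℝ (frame lam q)) ∧
        -- gradient
        grad sphericalMetric (foldFun (firstCoord n) lam) q =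
          ((1 + ‖q‖ ^ 2) ^ 2 / 4) •
            (-(lam ^ 2) • e 0 + (2 * q (Fin.last n)) • e (Fin.last n)) ∧
        -- Hessian
        (∀ i j : Fin n,
          bil (hess sphericalMetric (foldFun (firstCoord n) lam) q) (frame lam q i) (frame lam q j) =
            if i = j then
              if i = 0 then
                2 * lam ^ 4 - 8 * lam ^ 4 * q 0 ^ 2 / (1 + ‖q‖ ^ 2)
                  - 2 * lam ^ 6 * q 0 / (1 + ‖q‖ ^ 2)
              else -(2 * lam ^ 2 * q 0 / (1 + ‖q‖ ^ 2))
            else 0) ∧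
        -- sectional curvatures of the coordinate planes
        (∀ i j : Fin n, i ≠ 0 → j ≠ 0 → i ≠ j →
          HasSec sphericalMetric (fold (nbhd n) (firstCoord n) lam) q (frame lam q i) (frame lam q j)
            (1 + 4 * lam ^ 4 * q 0 ^ 2 /
              ((1 + ‖q‖ ^ 2) ^ 2 *
                ip sphericalMetric q (grad sphericalMetric (foldFun (firstCoord n) lam) q)
                  (grad sphericalMetric (foldFun (firstCoord n) lam) q) *
                ip sphericalMetric q (frame lam q i) (frame lam q i) *
                ip sphericalMetric q (frame lam q j) (frame lam q j)))) ∧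
        (∀ j : Fin n, j ≠ 0 →
          HasSec sphericalMetric (fold (nbhd n) (firstCoord n) lam) q (frame lam q 0) (frame lam q j)
            (1 + xi lam (proj q))) ∧
        -- lower bound for all sectional curvatures
        (∀ u ∈ tangentVectors (fold (nbhd n) (firstCoord n) lam) q,
          ∀ w ∈ tangentVectors (fold (nbhd n) (firstCoord n) lam) q,
            LinearIndependent ℝ ![u, w] →
              ∃ s : ℝ, HasSec sphericalMetric (fold (nbhd n) (firstCoord n) lam) q u w s ∧
                1 + xi lam (proj q) ≤ s)) ∧
      (∀ x ∈ halfSpace n ∩ nbhd n, -(3 / 32) ≤ xi lam x) ∧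
      CurvatureBoundedBelow sphericalMetric (fold (nbhd n) (firstCoord n) lam) 0) ∧
    AssumptionH sphericalMetric (halfSpace n) (0 : Euc n) := by
  refine ⟨isBilliardTable_halfSpace, ?_, zero_mem_nbhd, isDefiningFunction_firstCoord isOpen_nbhd
    (Metric.isBounded_ball.subset Set.inter_subset_right), fun lam hlam => ?_, nbhd n, firstCoord n,
    zero_mem_nbhd, isDefiningFunction_firstCoord isOpen_nbhd
    (Metric.isBounded_ball.subset Set.inter_subset_right), 0,
    fun lam hlam => curvatureBoundedBelow_fold hlam.1.ne'⟩
  · rw [frontier_halfSpace_eq]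
    rfl
  have h0 : lam ≠ 0 := hlam.1.ne'
  refine ⟨fun q hq => ?_, fun x hx => neg_le_xi h0 hx, curvatureBoundedBelow_fold h0⟩
  have hq1 := (mem_fold_iff.mp hq).2
  have hq0 := nonneg_of_mem_fold h0 hq
  have ht := frame_tangent lam q
  refine ⟨⟨tangentVectors_fold isOpen_nbhd h0 hq, linearIndependent_frame h0 q⟩,
    grad_foldFun lam q, fun i j => ?_, fun i j hi hj hij => ?_, fun j hj => ?_,
    fun u hu w hw hli => exists_hasSec_fold isOpen_nbhd h0 hq hu hw hli⟩
  · rw [bil_hess_foldFun hq1 (ht i) (ht j), foldHess_frame hq1]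
  · rw [← foldSec_frame h0 hq1 hq0 hi hj hij]
    exact hasSec_fold isOpen_nbhd h0 hq (ht i) (ht j) (linearIndependent_frame_pair h0 q hij)
  · rw [← foldSec_frame_zero h0 hq1 hq0 hj]
    exact hasSec_fold isOpen_nbhd h0 hq (ht 0) (ht j) (linearIndependent_frame_pair h0 q hj.symm)
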